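/- Setting. $M_4$ is Minkowski space-time with metric $(\cdot,\cdot)$ of signature $(+,-,-,-)$. Two-forms $F_{\mu\nu}$ are multiplied by $(FG)_{\mu\nu}=F_{\mu\tau}G^{\tau}{}_{\nu}$; with $[F,G]=FG-GF$ they form the Lorentz Lie algebra. Put $(F,G)=-\tfrac12\operatorname{tr}(FG)$ and let $*$ be the dual operator. A two-form $U$ is unitary if $(U,U)=-1$ and $(U,*U)=0$. A two-form $F\neq 0$ is null if $(F,F)=(F,*F)=0$, and regular otherwise. If $F$ is regular, then $F=\alpha U-\tilde\alpha\,{*U}$ with $U$ unitary and $\alpha,\tilde\alpha\in\mathbb R$; $\{U,*U\}$ is the geometry of $F$ and $(\alpha,\tilde\alpha)$ its pair of eigenvalues (the eigenvalues of $F$ are $\pm\alpha,\pm i\tilde\alpha$); $U,\alpha,\tilde\alpha$ are determined up to a simultaneous change of sign. If $F$ is null, its geometry is $\{U,*U\}$ with $U=F$; if $F$ is null or zero, its pair of eigenvalues is $(0,0)$. For $U$ unitary or null, $\pi(U)$ is the image of $U$ (the plane spanned by $x,y$ if $U=x\wedge y$); it is a timelike plane if $U$ is unitary and a null plane if $U$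 is null. A two-form $H$ is a BCH composition $F\circ G=\log(\exp F\exp G)$ if $\exp H=\exp F\exp G$ and, for the self-dual parts $A=\tfrac12(F-i{*F})$, $B=\tfrac12(G-i{*G})$, $D=\tfrac12(H-i{*H})$, also $\exp D=\exp A\exp B$. Let $\mathcal A(F,G)$ be the Lie algebra generated by $F$ and $G$. Let $\mathrm{SH}(z)=\sinh z/z$, $\mathrm{SH}(0)=1$. Relative positions. The following are six possible positions of an ordered pair of planes $(P,Q)$: $\Pi_{1,1}$: $P=Q$ is a null plane; $\Pi_{1,2}$: $P=Q$ is a timelike plane; $\Pi_{2,1}$: $P$ and $Q$ are null planes whose intersection is a null line; $\Pi_{2,2}$: $P$ is timelike, $Q$ is null, and $P\cap Q$ is a null line; $\Pi_{\underline 2,2}$: $P$ is null, $Q$ is timelike, and $P\cap Q$ is a null line; $\Pi_{\underline 2,3}$: $P$ and $Q$ are timelike planes whose intersection is a null line. Algebras. A real null tetrad $\{l,m,p,q\}$ satisfies $(l,m)=1$, $(p,p)=(q,q)=-1$, all other products being $0$. Put $A_1=l\wedge m$, $A_2=p\wedge q$, $A_3=l\wedge p$, $A_4=l\wedge q$. A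 subalgebra is of one of the types below if, for some real null tetrad, it has the basis $R_6$: $A_1,A_3$; $R_7$: $A_1,A_2$; $R_8$: $A_3,A_4$; $R_{11}$: $A_2,A_3,A_4$; $R_{12}$: $A_1+\tau A_2,A_3,A_4$ for some $\tau\ne0$; $R_{14}$: $A_1,A_2,A_3,A_4$. Theorem. Let $F,G$ be non-zero two-forms with geometries $\{U,*U\}$ and $\{V,*V\}$. Consider the conditions: (1) for some BCH composition $F\circ G$ and a suitable choice of signs of the pairs of eigenvalues $(\alpha,\tilde\alpha)$ of $F$ and $(\beta,\tilde\beta)$ of $G$, $(\alpha+\beta,\tilde\alpha+\tilde\beta)$ is a pair of eigenvalues of $F\circ G$; (2) $\pi(U)$ and $\pi(V)$ have at least one common null direction; (3) the pair $(\pi(U),\pi(V))$ is in one and only one of the positions $\Pi_{1,1},\Pi_{1,2},\Pi_{2,1},\Pi_{2,2},\Pi_{\underline 2,2},\Pi_{\underline 2,3}$; (4) $\mathcal A(F,G)$ is of one of the types $R_6,R_7,R_8,R_{11},R_{12},R_{14}$; (5) the Killing–Cartan form of $\mathcal A(F,G)$ is singular. Then (2), (3) and (5) are equivalent. If $F$ and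 $G$ are linearly independent, they are equivalent to (4). If, with $a=\tfrac12(\alpha-i\tilde\alpha)$ and $b=\tfrac12(\beta-i\tilde\beta)$, the numbers $\mathrm{SH}(a)$, $\mathrm{SH}(b)$, $\mathrm{SH}(a+b)$ are non-zero for every choice of signs of the pairs of eigenvalues, they are equivalent to (1). In particular, under both assumptions the five conditions are equivalent. -/

import Mathlib

namespace Minkowski

open Matrix

noncomputable section

/-- Vectors of Minkowski space-time, in an orthonormal frame. -/
abbrev Vec := Fin 4 → ℝ

/-- The Lorentzian metric, of signature `(+,-,-,-)`. -/
def eta : Matrix (Fin 4) (Fin 4) ℝ := Matrix.diagonal ![1, -1, -1, -1]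

/-- The scalar product `(x,y)` of vectors. -/
def ip (x y : Vec) : ℝ := x ⬝ᵥ (eta *ᵥ y)

/-- Two-forms on Minkowski space-time. A two-form `F_{μν}` is represented by its mixed components
`F^μ_ν`, an endomorphism that is skew-adjoint for the metric; the product
`(FG)_{μν} = F_{μτ} G^τ_ν` is then the product of matrices, and the Lie algebra of two-forms, with
`[F,G] = FG - GF`, is the Lorentz algebra. -/
abbrev TwoForm : Type := ↥(skewAdjointMatricesLieSubalgebra eta)

/-- The Levi-Civita symbol. -/
def leviCivita (μ ν ρ σ : Fin 4) : ℝ :=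
  (Matrix.of fun i j : Fin 4 => if ![μ, ν, ρ, σ] i = j then (1 : ℝ) else 0).det

/-- The covariant components `½ ε_{μνρσ} F^{ρσ}` of the dual, from the mixed components `M` of
`F`. -/
def dualCov (M : Matrix (Fin 4) (Fin 4) ℝ) : Matrix (Fin 4) (Fin 4) ℝ :=
  Matrix.of fun μ ν => (1 / 2 : ℝ) * ∑ ρ, ∑ σ, leviCivita μ ν ρ σ * (M * eta) ρ σ

theorem eta_mul_eta : eta * eta = 1 := by
  rw [eta, Matrix.diagonal_mul_diagonal, ← Matrix.diagonal_one]
  congr 1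
  funext i
  fin_cases i <;> simp

theorem eta_transpose : etaᵀ = eta := by
  simp [eta]

theorem leviCivita_swap (μ ν ρ σ : Fin 4) : leviCivita ν μ ρ σ = -leviCivita μ ν ρ σ := by
  unfold leviCivita
  rw [show (Matrix.of fun i j : Fin 4 => if ![ν, μ, ρ, σ] i = j then (1 : ℝ) else 0) =
    (Matrix.of fun i j : Fin 4 => if ![μ, ν, ρ, σ] i = j then (1 : ℝ) else 0).submatrix
      (Equiv.swap (0 : Fin 4) 1) id from ?_, Matrix.det_permute]
  · rw [Equiv.Perm.sign_swap (by decide)]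
    simp
  · ext i j
    fin_cases i <;> simp [Equiv.swap_apply_def] <;> rfl

theorem dualCov_transpose (M : Matrix (Fin 4) (Fin 4) ℝ) : (dualCov M)ᵀ = -dualCov M := by
  ext μ ν
  simp only [dualCov, Matrix.transpose_apply, Matrix.of_apply, Matrix.neg_apply]
  rw [← mul_neg, ← Finset.sum_neg_distrib]
  congr 1
  refine Finset.sum_congr rfl fun ρ _ => ?_
  rw [← Finset.sum_neg_distrib]
  refine Finset.sum_congr rfl fun σ _ => ?_
  rw [leviCivita_swap, neg_mul]

/-- The dual `*F` of a two-form. -/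
def star (F : TwoForm) : TwoForm :=
  ⟨eta * dualCov F.1, by
    rw [mem_skewAdjointMatricesLieSubalgebra, mem_skewAdjointMatricesSubmodule]
    simp only [Matrix.IsSkewAdjoint, Matrix.IsAdjointPair]
    rw [Matrix.transpose_mul, eta_transpose, dualCov_transpose, Matrix.mul_assoc, eta_mul_eta,
      Matrix.mul_neg, ← Matrix.mul_assoc, eta_mul_eta, Matrix.mul_one, Matrix.one_mul]⟩

/-- The scalar product `(F,G) = -½ tr (FG)` of two-forms. -/
def form (F G : TwoForm) : ℝ := -(1 / 2) * (F.1 * G.1).trace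

/-- The exterior product `x ∧ y`, with components `x_μ y_ν - y_μ x_ν`. -/
def wedge (x y : Vec) : TwoForm :=
  ⟨(Matrix.vecMulVec x y - Matrix.vecMulVec y x) * eta, by
    rw [mem_skewAdjointMatricesLieSubalgebra, mem_skewAdjointMatricesSubmodule]
    simp only [Matrix.IsSkewAdjoint, Matrix.IsAdjointPair]
    rw [Matrix.transpose_mul, eta_transpose, Matrix.transpose_sub, Matrix.transpose_vecMulVec,
      Matrix.transpose_vecMulVec, ← Matrix.neg_mul, neg_sub, Matrix.mul_assoc]⟩

/-! ### Eigenvalues and geometry of a two-form -/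

/-- `U` is a unitary two-form. -/
def IsUnitary (U : TwoForm) : Prop := form U U = -1 ∧ form U (star U) = 0

/-- Both invariants `(F,F)` and `(F,*F)` vanish; a non vanishing such two-form is called null. -/
def IsSingular (F : TwoForm) : Prop := form F F = 0 ∧ form F (star F) = 0

/-- `(α, α')` is a pair of eigenvalues of `F` (all the eigenvalues being `±α` and `±iα'`):
`F = α U - α' *U` with `U` unitary if `F` is regular, and `α = α' = 0` if `F` is null or zero.
The pair is unique up to the simultaneous change of sign of `α`, `α'` and `U`. -/
def HasEigenvalues (F : TwoForm) (α α' : ℝ) : Prop :=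
  (∃ U, IsUnitary U ∧ F = α • U - α' • star U) ∨ (IsSingular F ∧ α = 0 ∧ α' = 0)

/-- `{U, *U}` is the geometry of the non vanishing two-form `F`: `U` is unitary and
`F = α U - α' *U` if `F` is regular, and `U = F` if `F` is null. -/
def HasGeometry (F U : TwoForm) : Prop :=
  F ≠ 0 ∧
    ((¬ IsSingular F ∧ IsUnitary U ∧ ∃ α α' : ℝ, F = α • U - α' • star U) ∨
      (IsSingular F ∧ U = F))

/-- The plane `π(U)` of a simple two-form `U = x ∧ y`, that is, the span of `x` and `y`, which is
the image of `U`. -/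
def plane (U : TwoForm) : Submodule ℝ Vec := LinearMap.range (Matrix.toLin' U.1)

/-! ### The Baker-Campbell-Hausdorff composition -/

/-- The self-dual complex two-form `½ (F - i *F)`. -/
def selfDual (F : TwoForm) : Matrix (Fin 4) (Fin 4) ℂ :=
  (1 / 2 : ℂ) • (F.1.map Complex.ofReal - Complex.I • (star F).1.map Complex.ofReal)

/-- `H` is a BCH composition `F ∘ G = log (exp F exp G)` of `F` and `G`, that is,
`exp H = exp F exp G`, where the logarithm is taken through the self-dual parts `A`, `B`, `D` of
`F`, `G`, `H`: `exp D = exp A exp B`. -/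
def IsBCH (F G H : TwoForm) : Prop :=
  NormedSpace.exp H.1 = NormedSpace.exp F.1 * NormedSpace.exp G.1 ∧
    NormedSpace.exp (selfDual H) = NormedSpace.exp (selfDual F) * NormedSpace.exp (selfDual G)

/-- The eigenvalues of `F ∘ G` are the sums of those of `F` and `G`. -/
def EigenvaluesAdd (F G : TwoForm) : Prop :=
  ∃ (H : TwoForm) (α α' β β' : ℝ), IsBCH F G H ∧ HasEigenvalues F α α' ∧ HasEigenvalues G β β' ∧
    HasEigenvalues H (α + β) (α' + β')

/-- The entire function `sinh z / z`. -/
def SH (z : ℂ) : ℂ := if z = 0 then 1 else Complex.sinh z / z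

/-- The complex invariant `½ (α - i α')`. -/
def invariant (α α' : ℝ) : ℂ := (1 / 2 : ℂ) * ((α : ℂ) - Complex.I * (α' : ℂ))

/-- The function `SH` vanishes neither at the invariants `a`, `b` of `F`, `G` nor at their sums
`a + b` (the invariants being defined up to sign, the sums are `±a ± b`). -/
def NonResonant (F G : TwoForm) : Prop :=
  ∀ α α' β β' : ℝ, HasEigenvalues F α α' → HasEigenvalues G β β' →
    SH (invariant α α') ≠ 0 ∧ SH (invariant β β') ≠ 0 ∧
      SH (invariant α α' + invariant β β') ≠ 0

/-! ### Relative positions of two planes -/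

/-- The two subspaces have at least one common null direction. -/
def ShareNullDirection (P Q : Submodule ℝ Vec) : Prop :=
  ∃ x : Vec, x ≠ 0 ∧ ip x x = 0 ∧ x ∈ P ∧ x ∈ Q

/-- A timelike plane; it has two null directions. -/
def IsTimelikePlane (P : Submodule ℝ Vec) : Prop :=
  Module.finrank ℝ P = 2 ∧ ∃ x ∈ P, 0 < ip x x

/-- A null plane, i.e. a plane on which the metric is degenerate; it has one null direction. -/
def IsNullPlane (P : Submodule ℝ Vec) : Prop :=
  Module.finrank ℝ P = 2 ∧ ∃ x ∈ P, x ≠ 0 ∧ ∀ y ∈ P, ip x y = 0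

/-- A null line. -/
def IsNullLine (N : Submodule ℝ Vec) : Prop :=
  ∃ x : Vec, x ≠ 0 ∧ ip x x = 0 ∧ N = Submodule.span ℝ {x}

/-- Labels of six relative positions of an ordered pair of planes; the letter `u` stands for the
underlining of the index that it follows. The first index is the number of distinct planes of the
pair, and the second one the number of distinct null directions that they contain. -/
inductive RelPos
  | p11
  | p12
  | p21
  | p22
  | p2u2
  | p2u3

/-- The ordered pair of planes `(P, Q)` is in the given relative position. -/
def HasRelPos (P Q : Submodule ℝ Vec) : RelPos → Prop
  | .p11 => IsNullPlane P ∧ P = Q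
  | .p12 => IsTimelikePlane P ∧ P = Q
  | .p21 => IsNullPlane P ∧ IsNullPlane Q ∧ IsNullLine (P ⊓ Q)
  | .p22 => IsTimelikePlane P ∧ IsNullPlane Q ∧ IsNullLine (P ⊓ Q)
  | .p2u2 => IsNullPlane P ∧ IsTimelikePlane Q ∧ IsNullLine (P ⊓ Q)
  | .p2u3 => IsTimelikePlane P ∧ IsTimelikePlane Q ∧ IsNullLine (P ⊓ Q)

/-! ### Subalgebras of the Lorentz algebra -/

/-- A real null tetrad `{l, m, p, q}`. -/
structure NullTetrad where
  (l m p q : Vec)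
  ll : ip l l = 0
  mm : ip m m = 0
  lp : ip l p = 0
  lq : ip l q = 0
  mp : ip m p = 0
  mq : ip m q = 0
  pq : ip p q = 0
  lm : ip l m = 1
  pp : ip p p = -1
  qq : ip q q = -1

namespace NullTetrad

variable (T : NullTetrad)

def A1 : TwoForm := wedge T.l T.m
def A2 : TwoForm := wedge T.p T.q
def A3 : TwoForm := wedge T.l T.p
def A4 : TwoForm := wedge T.l T.q

end NullTetrad

/-- `L` is of type `R6`: it is spanned by `A1`, `A3` for some null tetrad. The other types below
are defined in the same way. -/
def IsR6 (L : LieSubalgebra ℝ TwoForm) : Prop :=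
  ∃ T : NullTetrad, L.toSubmodule = Submodule.span ℝ {T.A1, T.A3}

def IsR7 (L : LieSubalgebra ℝ TwoForm) : Prop :=
  ∃ T : NullTetrad, L.toSubmodule = Submodule.span ℝ {T.A1, T.A2}

def IsR8 (L : LieSubalgebra ℝ TwoForm) : Prop :=
  ∃ T : NullTetrad, L.toSubmodule = Submodule.span ℝ {T.A3, T.A4}

def IsR11 (L : LieSubalgebra ℝ TwoForm) : Prop :=
  ∃ T : NullTetrad, L.toSubmodule = Submodule.span ℝ {T.A2, T.A3, T.A4}

def IsR12 (L : LieSubalgebra ℝ TwoForm) : Prop :=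
  ∃ (T : NullTetrad) (τ : ℝ), τ ≠ 0 ∧
    L.toSubmodule = Submodule.span ℝ {T.A1 + τ • T.A2, T.A3, T.A4}

def IsR14 (L : LieSubalgebra ℝ TwoForm) : Prop :=
  ∃ T : NullTetrad, L.toSubmodule = Submodule.span ℝ {T.A1, T.A2, T.A3, T.A4}

/-- The Lie algebra `A(F,G)` generated by `F` and `G`. -/
def genAlg (F G : TwoForm) : LieSubalgebra ℝ TwoForm :=
  LieSubalgebra.lieSpan ℝ TwoForm {F, G}

end

end Minkowski

/-!
A two-form with electric part `e` and magnetic part `b` is encoded by the complex vector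
`z = e + i b` (`cvec`). The dual becomes multiplication by `i`, the bracket `i` times the cross
product, and the invariants of `F` become `z · z`: the form is unitary if `z · z = 1`, null if
`z · z = 0`, and `(α, α')` is a pair of eigenvalues exactly if `z · z = (α - i α')²`
(`hasEigenvalues_iff`). All the conditions on `F`, `G`, with vectors `z`, `w`, are shown to be
equivalent to the vanishing of the complex Gram determinant
`gram F G = (z · z) (w · w) - (z · w)²`, which up to sign is the square of the vector of `[F, G]`.

* Eigenvalues (`gram_eq_zero_of_eigenvaluesAdd`, `eigenvaluesAdd_of_gram_eq_zero`). The self-dual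
  part `A` of `F` satisfies `A² = a²`, whence `exp A = cosh a + SH a • A`, and the trace of `A B` is
  `z · w`. The trace of `exp A exp B` is `4 cosh (a + b)` exactly if `z · w = 4ab`, and for some
  choice of signs this means `(z · w)² = (z · z) (w · w)`. When it holds, the logarithm with
  invariant `a + b` is obtained by dividing the trace-free part of `exp A exp B` by `SH (a + b)`.
* Null directions (`shareNullDirection_iff`). Let `X`, `Y` be the traceless two by two matrices of
  `F` and `G` in the spinor representation. A null vector is, up to sign, `κ κ*` for a spinor `κ`,
  and it lies in the plane of a two-form exactly if `κ` is an eigenvector of the matrix of this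
  form. Traceless two by two matrices `X`, `Y` have a common eigenvector exactly if `[X, Y]` is
  nilpotent, which is the vanishing of the Gram determinant.
* Relative positions (`shareNullDirection_iff_existsUnique`). The plane of a unitary or null form is
  timelike or null but not both, and it contains a null direction; the rest is linear algebra.
* Algebras. If the Gram determinant vanishes, `F` and `G` lie in the stabilizer of a null direction,
  the algebra spanned by `A1`, ..., `A4` for some null tetrad. In complex coordinates it has the
  bracket `[(h, n), (h', n')] = (0, h n' - h' n)`, from which the algebras generated by two elements
  are read off (`NullTetrad.isListed_genAlg`). It is metabelian, and the Killing form of a nonzero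
  metabelian algebra is degenerate (`not_nondegenerate_of_metabelian`). If the Gram determinant does
  not vanish, `F`, `G`, `[F, G]` are a complex basis of the Lorentz algebra. Depending on whether
  the Gram matrix is real, the generated algebra is their real span or the whole Lorentz algebra,
  and its Killing form is nondegenerate (`nondegenerate_of_gram_ne_zero`).
-/

namespace Minkowski

open Matrix

noncomputable section

/-! ### Two-forms as complex three-vectors -/

/-- The endomorphism of Minkowski space with electric part `re z` and magnetic part `im z`. -/
def fieldMatrix (z : Fin 3 → ℂ) : Matrix (Fin 4) (Fin 4) ℝ :=
  !![0, (z 0).re, (z 1).re, (z 2).re;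
     (z 0).re, 0, (z 2).im, -(z 1).im;
     (z 1).re, -(z 2).im, 0, (z 0).im;
     (z 2).re, (z 1).im, -(z 0).im, 0]

theorem mem_skewAdjoint_iff (M : Matrix (Fin 4) (Fin 4) ℝ) :
    M ∈ skewAdjointMatricesLieSubalgebra eta ↔ Mᵀ * eta = -(eta * M) := by
  rw [mem_skewAdjointMatricesLieSubalgebra, mem_skewAdjointMatricesSubmodule]
  simp only [Matrix.IsSkewAdjoint, Matrix.IsAdjointPair, Matrix.mul_neg]

theorem fieldMatrix_mem (z : Fin 3 → ℂ) :
    fieldMatrix z ∈ skewAdjointMatricesLieSubalgebra eta := by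
  rw [mem_skewAdjoint_iff]
  ext i j
  fin_cases i <;> fin_cases j <;>
    simp [fieldMatrix, eta]

/-- The complex vector `e + i b` of a two-form with electric part `e` and magnetic part `b`. -/
def cvecFun (F : TwoForm) : Fin 3 → ℂ :=
  ![⟨F.1 0 1, F.1 2 3⟩, ⟨F.1 0 2, F.1 3 1⟩, ⟨F.1 0 3, F.1 1 2⟩]

theorem fieldMatrix_cvecFun (F : TwoForm) : fieldMatrix (cvecFun F) = F.1 := by
  have h := (mem_skewAdjoint_iff F.1).1 F.2
  have e : ∀ i j, F.1 j i * ![1, -1, -1, -1] j = -(![1, -1, -1, -1] i * F.1 i j) := fun i j => by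
    simpa [eta] using congrFun (congrFun h i) j
  ext i j
  fin_cases i <;> fin_cases j
  all_goals simp [fieldMatrix, cvecFun]
  · have := e 0 0; simp at this; linarith
  · have := e 0 1; simp at this; linarith
  · have := e 1 1; simp at this; linarith
  · have := e 1 3; simp at this; linarith
  · have := e 0 2; simp at this; linarith
  · have := e 1 2; simp at this; linarith
  · have := e 2 2; simp at this; linarith
  · have := e 0 3; simp at this; linarith
  · have := e 2 3; simp at this; linarith
  · have := e 3 3; simp at this; linarith

/-- The real linear isomorphism between two-forms and complex three-vectors `e + i b`. Under it the
dual is multiplication by `i` (`cvec_star`), the bracket is `i` times the cross product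
(`cvec_lie`), and the two invariants of a two-form are the real and imaginary parts of the complex
square of its vector (`form_self_eq`, `form_star_eq`). -/
def cvec : TwoForm ≃ₗ[ℝ] (Fin 3 → ℂ) where
  toFun := cvecFun
  map_add' F G := by
    ext i
    fin_cases i <;> simp [cvecFun, Complex.ext_iff]
  map_smul' r F := by
    ext i
    fin_cases i <;> simp [cvecFun, Complex.ext_iff]
  invFun z := ⟨fieldMatrix z, fieldMatrix_mem z⟩
  left_inv F := Subtype.ext (fieldMatrix_cvecFun F)
  right_inv z := by
    ext i
    fin_cases i <;> simp [cvecFun, fieldMatrix]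

theorem val_eq (F : TwoForm) : F.1 = fieldMatrix (cvec F) := (fieldMatrix_cvecFun F).symm

theorem cvec_of_val_eq {F : TwoForm} {z : Fin 3 → ℂ} (h : F.1 = fieldMatrix z) : cvec F = z := by
  rw [← cvec.apply_symm_apply z]
  exact congrArg cvec (Subtype.ext h)

/-- The Levi-Civita symbol is, up to the factor `12`, the Vandermonde product of its indices. -/
theorem leviCivita_eq_prod (μ ν ρ σ : Fin 4) :
    leviCivita μ ν ρ σ =
      (((ν : ℤ) - μ) * (ρ - μ) * (σ - μ) * (ρ - ν) * (σ - ν) * (σ - ρ) : ℤ) / 12 := by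
  have key : ∀ μ ν ρ σ : Fin 4,
      12 * (Matrix.of fun i j : Fin 4 => if ![μ, ν, ρ, σ] i = j then (1 : ℤ) else 0).det =
        (((ν : ℕ) : ℤ) - (μ : ℕ)) * ((ρ : ℕ) - (μ : ℕ)) * ((σ : ℕ) - (μ : ℕ)) *
          ((ρ : ℕ) - (ν : ℕ)) * ((σ : ℕ) - (ν : ℕ)) * ((σ : ℕ) - (ρ : ℕ)) := by
    simp only [Matrix.det_succ_row_zero, Fin.sum_univ_succ, Matrix.det_fin_zero]
    decide +kernel
  rw [eq_div_iff (by norm_num), ← key, mul_comm, Int.cast_mul, Int.cast_det, leviCivita]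
  norm_num
  congr 1
  ext i j
  simp

theorem cvec_star (F : TwoForm) : cvec (star F) = Complex.I • cvec F := by
  have key : ∀ i j, (star F).1 i j = fieldMatrix (Complex.I • cvec F) i j := by
    intro i j
    rw [show (star F).1 = eta * dualCov F.1 from rfl, val_eq F]
    fin_cases i <;> fin_cases j <;>
    simp [dualCov, eta, fieldMatrix, leviCivita_eq_prod, Fin.sum_univ_four] <;> ring
  exact cvec_of_val_eq (by ext i j; exact key i j)

theorem lie_val (F G : TwoForm) : (⁅F, G⁆ : TwoForm).1 = F.1 * G.1 - G.1 * F.1 := rfl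

theorem cvec_lie (F G : TwoForm) : cvec ⁅F, G⁆ = Complex.I • (cvec F ⨯₃ cvec G) := by
  apply cvec_of_val_eq
  rw [lie_val, val_eq F, val_eq G]
  ext i j
  fin_cases i <;> fin_cases j <;>
    simp [fieldMatrix, cross_apply] <;> ring

theorem form_eq (F G : TwoForm) : form F G = -(cvec F ⬝ᵥ cvec G).re := by
  rw [form, val_eq F, val_eq G]
  simp [fieldMatrix, Matrix.trace, Fin.sum_univ_succ, dotProduct]
  ring

theorem form_star_eq (F G : TwoForm) : form F (star G) = (cvec F ⬝ᵥ cvec G).im := by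
  rw [form_eq, cvec_star]
  simp

theorem isUnitary_iff (U : TwoForm) : IsUnitary U ↔ cvec U ⬝ᵥ cvec U = 1 := by
  rw [IsUnitary, form_eq, form_star_eq, Complex.ext_iff, neg_inj]
  simp

theorem isSingular_iff (F : TwoForm) : IsSingular F ↔ cvec F ⬝ᵥ cvec F = 0 := by
  rw [IsSingular, form_eq, form_star_eq, Complex.ext_iff, neg_eq_zero]
  simp

theorem cvec_smul_sub_smul_star (U : TwoForm) (α α' : ℝ) :
    cvec (α • U - α' • star U) = (2 * invariant α α') • cvec U := by
  rw [map_sub, map_smul, map_smul, cvec_star]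
  ext i
  simp [invariant]
  ring

/-- A pair is a pair of eigenvalues exactly if it has the right complex square. -/
theorem hasEigenvalues_iff (F : TwoForm) (α α' : ℝ) :
    HasEigenvalues F α α' ↔ cvec F ⬝ᵥ cvec F = 4 * invariant α α' ^ 2 := by
  have hinv : invariant α α' = 0 ↔ α = 0 ∧ α' = 0 := by
    simp [invariant, Complex.ext_iff]
  constructor
  · rintro (⟨U, hU, rfl⟩ | ⟨hF, rfl, rfl⟩)
    · rw [cvec_smul_sub_smul_star, smul_dotProduct, dotProduct_smul, (isUnitary_iff U).1 hU]
      simp only [smul_eq_mul]; ring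
    · rw [(isSingular_iff F).1 hF, hinv.2 ⟨rfl, rfl⟩]; simp
  · intro h
    by_cases h0 : invariant α α' = 0
    · right
      rw [h0] at h
      exact ⟨(isSingular_iff F).2 (by simpa using h), hinv.1 h0⟩
    · left
      refine ⟨cvec.symm ((2 * invariant α α')⁻¹ • cvec F), ?_, ?_⟩
      · rw [isUnitary_iff, LinearEquiv.apply_symm_apply, smul_dotProduct, dotProduct_smul, h]
        simp only [smul_eq_mul]
        field_simp
        norm_num
      · apply cvec.injective
        rw [cvec_smul_sub_smul_star, LinearEquiv.apply_symm_apply, smul_smul,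
          mul_inv_cancel₀ (by simpa using h0), one_smul]

/-- The Gram determinant of the complex vectors of two two-forms. It is the criterion through which
all the conditions are compared. -/
def gram (F G : TwoForm) : ℂ :=
  (cvec F ⬝ᵥ cvec F) * (cvec G ⬝ᵥ cvec G) - (cvec F ⬝ᵥ cvec G) ^ 2

theorem exists_invariant_eq (c : ℂ) : ∃ α α' : ℝ, invariant α α' = c :=
  ⟨2 * c.re, -2 * c.im, by
    apply Complex.ext <;> simp [invariant]⟩

/-! ### Exponentials of self-dual two-forms -/

/-- The self-dual matrix with complex vector `z`; it depends complex linearly on `z`. -/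
def sdMatrix (z : Fin 3 → ℂ) : Matrix (Fin 4) (Fin 4) ℂ :=
  (1 / 2 : ℂ) • !![0, z 0, z 1, z 2;
     z 0, 0, -Complex.I * z 2, Complex.I * z 1;
     z 1, Complex.I * z 2, 0, -Complex.I * z 0;
     z 2, -Complex.I * z 1, Complex.I * z 0, 0]

theorem selfDual_eq (F : TwoForm) : selfDual F = sdMatrix (cvec F) := by
  rw [selfDual, val_eq (star F), cvec_star, val_eq F]
  ext i j
  fin_cases i <;> fin_cases j <;>
    simp [sdMatrix, fieldMatrix, Complex.ext_iff]

theorem sdMatrix_add (z w : Fin 3 → ℂ) : sdMatrix (z + w) = sdMatrix z + sdMatrix w := by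
  ext i j
  fin_cases i <;> fin_cases j <;> simp [sdMatrix] <;> ring

theorem sdMatrix_smul (c : ℂ) (z : Fin 3 → ℂ) : sdMatrix (c • z) = c • sdMatrix z := by
  ext i j
  fin_cases i <;> fin_cases j <;> simp [sdMatrix] <;> ring

theorem trace_sdMatrix (z : Fin 3 → ℂ) : (sdMatrix z).trace = 0 := by
  simp [sdMatrix, Matrix.trace, Fin.sum_univ_four]

/-- Self-dual matrices multiply like quaternions. -/
theorem sdMatrix_mul (z w : Fin 3 → ℂ) :
    sdMatrix z * sdMatrix w =
      ((z ⬝ᵥ w) / 4) • (1 : Matrix (Fin 4) (Fin 4) ℂ) +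
        sdMatrix ((Complex.I / 2) • (z ⨯₃ w)) := by
  have hI : Complex.I ^ 2 = -1 := Complex.I_sq
  ext i j
  fin_cases i <;> fin_cases j <;>
    simp [sdMatrix, Matrix.mul_apply, Fin.sum_univ_four, cross_apply, dotProduct,
      Fin.sum_univ_three] <;> ring_nf <;> simp only [hI] <;> ring

theorem sdMatrix_sq (z : Fin 3 → ℂ) :
    sdMatrix z ^ 2 = ((z ⬝ᵥ z) / 4) • (1 : Matrix (Fin 4) (Fin 4) ℂ) := by
  rw [sq, sdMatrix_mul, cross_self, smul_zero]
  have : sdMatrix 0 = 0 := by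
    simpa using sdMatrix_smul 0 0
  rw [this, add_zero]

theorem sinh_eq_SH_mul (a : ℂ) : Complex.sinh a = SH a * a := by
  rw [SH]
  split_ifs with h
  · simp [h]
  · field_simp

theorem hasSum_of_eq {E : Type*} [AddCommMonoid E] [TopologicalSpace E] {f g : ℕ → E} {s : E}
    (h : HasSum g s) (e : ∀ n, f n = g n) : HasSum f s := by
  rwa [funext e]

theorem hasSum_SH (a : ℂ) :
    HasSum (fun n : ℕ => a ^ (2 * n) / ((2 * n + 1).factorial : ℂ)) (SH a) := by
  by_cases h : a = 0
  · subst h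
    rw [SH, if_pos rfl]
    refine hasSum_of_eq (hasSum_ite_eq (0 : ℕ) (1 : ℂ)) fun n => ?_
    rcases n with _ | n <;> simp
  · rw [SH, if_neg h]
    refine hasSum_of_eq ((Complex.hasSum_sinh a).div_const a) fun n => ?_
    rw [pow_succ]
    field_simp

/-- Euler's formula for a matrix whose square is a scalar. -/
theorem exp_of_sq_eq_smul_one {n : Type*} [Fintype n] [DecidableEq n] (M : Matrix n n ℂ) (a : ℂ)
    (hM : M ^ 2 = (a ^ 2) • (1 : Matrix n n ℂ)) :
    NormedSpace.exp M = Complex.cosh a • (1 : Matrix n n ℂ) + SH a • M := by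
  have heven : ∀ k : ℕ, M ^ (2 * k) = (a ^ (2 * k)) • (1 : Matrix n n ℂ) := fun k => by
    rw [pow_mul, hM, smul_pow, one_pow, pow_mul]
  rw [NormedSpace.exp_eq_tsum ℂ]
  refine HasSum.tsum_eq (HasSum.even_add_odd ?_ ?_)
  · refine hasSum_of_eq
      ((Complex.hasSum_cosh a).smul_const (1 : Matrix n n ℂ)) fun k => ?_
    rw [heven, smul_smul]
    congr 1
    ring
  · refine hasSum_of_eq ((hasSum_SH a).smul_const M) fun k => ?_
    rw [pow_succ, heven, smul_mul_assoc, one_mul, smul_smul]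
    congr 1
    ring

theorem exp_sdMatrix (z : Fin 3 → ℂ) (a : ℂ) (h : z ⬝ᵥ z = 4 * a ^ 2) :
    NormedSpace.exp (sdMatrix z) =
      Complex.cosh a • (1 : Matrix (Fin 4) (Fin 4) ℂ) + SH a • sdMatrix z := by
  apply exp_of_sq_eq_smul_one
  rw [sdMatrix_sq, h]
  congr 1
  ring

theorem exp_map_conj (M : Matrix (Fin 4) (Fin 4) ℂ) :
    NormedSpace.exp (M.map (starRingEnd ℂ)) = (NormedSpace.exp M).map (starRingEnd ℂ) := by
  have h1 := Matrix.exp_conjTranspose M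
  have h2 := Matrix.exp_transpose (Mᴴ)
  rw [h1] at h2
  have e : ∀ N : Matrix (Fin 4) (Fin 4) ℂ, N.map (starRingEnd ℂ) = Nᴴᵀ := fun N => by
    ext i j; simp
  rw [e, e, h2]

theorem exp_map_ofReal (M : Matrix (Fin 4) (Fin 4) ℝ) :
    NormedSpace.exp (M.map Complex.ofReal) = (NormedSpace.exp M).map Complex.ofReal := by
  have hc : Continuous (Complex.ofRealHom.mapMatrix (m := Fin 4)) :=
    continuous_id.matrix_map Complex.continuous_ofReal
  let _ : NormedRing (Matrix (Fin 4) (Fin 4) ℝ) := Matrix.linftyOpNormedRing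
  let _ : NormedAlgebra ℝ (Matrix (Fin 4) (Fin 4) ℝ) := Matrix.linftyOpNormedAlgebra
  let _ : NormedAlgebra ℚ (Matrix (Fin 4) (Fin 4) ℝ) := NormedAlgebra.restrictScalars ℚ ℝ _
  let _ : NormedRing (Matrix (Fin 4) (Fin 4) ℂ) := Matrix.linftyOpNormedRing
  exact (NormedSpace.map_exp (Complex.ofRealHom.mapMatrix (m := Fin 4)) hc M).symm

/-- A two-form is the sum of its self-dual part and the conjugate of this part. -/
theorem map_ofReal_eq (F : TwoForm) :
    F.1.map Complex.ofReal = sdMatrix (cvec F) + (sdMatrix (cvec F)).map (starRingEnd ℂ) := by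
  rw [val_eq F]
  ext i j
  fin_cases i <;> fin_cases j <;>
    simp [sdMatrix, fieldMatrix, Complex.ext_iff] <;> ring

/-- The self-dual and the anti-self-dual matrices commute. -/
theorem sdMatrix_mul_conj (z w : Fin 3 → ℂ) :
    sdMatrix z * (sdMatrix w).map (starRingEnd ℂ) =
      (sdMatrix w).map (starRingEnd ℂ) * sdMatrix z := by
  have hI : Complex.I ^ 2 = -1 := Complex.I_sq
  ext i j
  fin_cases i <;> fin_cases j <;>
    simp [sdMatrix, Matrix.mul_apply, Fin.sum_univ_four] <;> ring_nf <;> simp only [hI] <;> ring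

theorem exists_sq_eq (c : ℂ) : ∃ a : ℂ, c = 4 * a ^ 2 := by
  obtain ⟨a, ha⟩ := IsAlgClosed.exists_pow_nat_eq (c / 4) (n := 2) two_pos
  exact ⟨a, by rw [ha]; ring⟩

theorem exp_map_ofReal_eq (F : TwoForm) :
    (NormedSpace.exp F.1).map Complex.ofReal =
      NormedSpace.exp (sdMatrix (cvec F)) *
        (NormedSpace.exp (sdMatrix (cvec F))).map (starRingEnd ℂ) := by
  rw [← exp_map_ofReal, map_ofReal_eq, Matrix.exp_add_of_commute _ _ (sdMatrix_mul_conj _ _),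
    exp_map_conj]

/-- The exponential of a two-form is determined by that of its self-dual part, so that the second
condition on a composition implies the first one. -/
theorem isBCH_of_exp_sdMatrix {F G H : TwoForm}
    (h : NormedSpace.exp (sdMatrix (cvec H)) =
      NormedSpace.exp (sdMatrix (cvec F)) * NormedSpace.exp (sdMatrix (cvec G))) :
    IsBCH F G H := by
  refine ⟨?_, by simpa only [selfDual_eq] using h⟩
  apply Matrix.map_injective Complex.ofReal_injective
  have hcomm : Commute (NormedSpace.exp (sdMatrix (cvec G)))
      ((NormedSpace.exp (sdMatrix (cvec F))).map (starRingEnd ℂ)) := by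
    obtain ⟨a, ha⟩ := exists_sq_eq (cvec F ⬝ᵥ cvec F)
    obtain ⟨b, hb⟩ := exists_sq_eq (cvec G ⬝ᵥ cvec G)
    have hs : ∀ (c : ℂ) (M : Matrix (Fin 4) (Fin 4) ℂ),
        (c • M).map (starRingEnd ℂ) = starRingEnd ℂ c • M.map (starRingEnd ℂ) := fun c M => by
      ext i j; simp
    rw [exp_sdMatrix _ a ha, exp_sdMatrix _ b hb, Matrix.map_add _ (map_add _), hs, hs,
      Matrix.map_one _ (map_zero _) (map_one _)]
    have h1 : Commute (sdMatrix (cvec G)) ((sdMatrix (cvec F)).map (starRingEnd ℂ)) :=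
      sdMatrix_mul_conj _ _
    exact (((Commute.one_left _).smul_left _).add_left
      (((Commute.one_right _).smul_right _).add_right (h1.smul_right _) |>.smul_left _))
  change (NormedSpace.exp H.1).map Complex.ofReal =
    (NormedSpace.exp F.1 * NormedSpace.exp G.1).map Complex.ofReal
  have hm : (NormedSpace.exp F.1 * NormedSpace.exp G.1).map Complex.ofReal =
      (NormedSpace.exp F.1).map Complex.ofReal * (NormedSpace.exp G.1).map Complex.ofReal :=
    Matrix.map_mul (f := Complex.ofRealHom)
  have hm' : ∀ M N : Matrix (Fin 4) (Fin 4) ℂ, (M * N).map (starRingEnd ℂ) =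
      M.map (starRingEnd ℂ) * N.map (starRingEnd ℂ) := fun M N => Matrix.map_mul
  rw [hm, exp_map_ofReal_eq, exp_map_ofReal_eq, exp_map_ofReal_eq, h, hm']
  simp only [mul_assoc]
  congr 1
  rw [← mul_assoc, hcomm.eq, mul_assoc]

/-- If the eigenvalues add up, comparing the traces of the two sides of `exp D = exp A exp B` gives
`cosh (a + b) = cosh a cosh b + SH a SH b (z · w) / 4`, so that `z · w = 4ab`. -/
theorem gram_eq_zero_of_eigenvaluesAdd {F G : TwoForm} (hN : NonResonant F G)
    (h : EigenvaluesAdd F G) : gram F G = 0 := by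
  obtain ⟨H, α, α', β, β', ⟨-, hexp⟩, hF, hG, hH⟩ := h
  obtain ⟨hSa, hSb, -⟩ := hN α α' β β' hF hG
  rw [hasEigenvalues_iff] at hF hG hH
  have hadd : invariant (α + β) (α' + β') = invariant α α' + invariant β β' := by
    simp [invariant]; ring
  rw [hadd] at hH
  generalize invariant α α' = a at *
  generalize invariant β β' = b at *
  rw [selfDual_eq, selfDual_eq, selfDual_eq, exp_sdMatrix _ _ hF, exp_sdMatrix _ _ hG,
    exp_sdMatrix _ _ hH] at hexp
  have htr := congrArg Matrix.trace hexp
  simp only [add_mul, mul_add, smul_mul_assoc, mul_smul_comm, one_mul, mul_one, sdMatrix_mul,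
    Matrix.trace_add, Matrix.trace_smul, trace_sdMatrix, Matrix.trace_one, Fintype.card_fin,
    smul_eq_mul, Complex.cosh_add, sinh_eq_SH_mul] at htr
  have hab : cvec F ⬝ᵥ cvec G = 4 * (a * b) := by
    apply mul_left_cancel₀ (mul_ne_zero hSa hSb)
    push_cast at htr
    linear_combination -htr
  rw [gram, hF, hG, hab]
  ring

/-- If the Gram determinant vanishes, the cross product of `z` and `w` is null. The logarithm of
`exp A exp B` with invariant `a + b` is then given by an explicit formula. -/
theorem eigenvaluesAdd_of_gram_eq_zero {F G : TwoForm} (hN : NonResonant F G)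
    (h : gram F G = 0) : EigenvaluesAdd F G := by
  rw [gram] at h
  obtain ⟨a, ha⟩ := exists_sq_eq (cvec F ⬝ᵥ cvec F)
  -- The sign of the invariant of `G` is chosen so that `z · w = 4ab`.
  obtain ⟨b, hb, hab⟩ : ∃ b : ℂ, cvec G ⬝ᵥ cvec G = 4 * b ^ 2 ∧
      cvec F ⬝ᵥ cvec G = 4 * (a * b) := by
    obtain ⟨b, hb⟩ := exists_sq_eq (cvec G ⬝ᵥ cvec G)
    rw [ha, hb] at h
    have : (cvec F ⬝ᵥ cvec G - 4 * (a * b)) * (cvec F ⬝ᵥ cvec G + 4 * (a * b)) = 0 := by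
      linear_combination -h
    rcases mul_eq_zero.1 this with h1 | h1
    · exact ⟨b, hb, by linear_combination h1⟩
    · exact ⟨-b, by rw [hb]; ring, by linear_combination h1⟩
  obtain ⟨α, α', rfl⟩ := exists_invariant_eq a
  obtain ⟨β, β', rfl⟩ := exists_invariant_eq b
  have hF := (hasEigenvalues_iff F α α').2 ha
  have hG := (hasEigenvalues_iff G β β').2 hb
  obtain ⟨-, -, hS⟩ := hN α α' β β' hF hG
  have hadd : invariant (α + β) (α' + β') = invariant α α' + invariant β β' := by
    simp [invariant]; ring
  generalize ea : invariant α α' = a at *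
  generalize eb : invariant β β' = b at *
  -- The vector of the composition is read off from the product of the two exponentials.
  set v : Fin 3 → ℂ := (SH (a + b))⁻¹ • ((SH a * Complex.cosh b) • cvec F +
    (Complex.cosh a * SH b) • cvec G + (SH a * SH b) • ((Complex.I / 2) • (cvec F ⨯₃ cvec G)))
    with hv
  have hvv : v ⬝ᵥ v = 4 * (a + b) ^ 2 := by
    have hcr : (cvec F ⨯₃ cvec G) ⬝ᵥ (cvec F ⨯₃ cvec G) = 0 := by
      rw [cross_dot_cross, dotProduct_comm (cvec G) (cvec F)]
      linear_combination h
    have h1 : cvec F ⬝ᵥ (cvec F ⨯₃ cvec G) = 0 := dot_self_cross _ _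
    have h2 : cvec G ⬝ᵥ (cvec F ⨯₃ cvec G) = 0 := dot_cross_self _ _
    have hs := sinh_eq_SH_mul (a + b)
    rw [Complex.sinh_add, sinh_eq_SH_mul, sinh_eq_SH_mul] at hs
    rw [hv]
    simp only [smul_dotProduct, dotProduct_smul, add_dotProduct, dotProduct_add, hcr, h1, h2,
      dotProduct_comm (cvec F ⨯₃ cvec G), dotProduct_comm (cvec G) (cvec F), ha, hb, hab,
      smul_eq_mul]
    field_simp
    linear_combination 16 * (SH a * a * Complex.cosh b + Complex.cosh a * (SH b * b) +
      SH (a + b) * (a + b)) * hs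
  refine ⟨cvec.symm v, α, α', β, β', isBCH_of_exp_sdMatrix ?_, hF, hG, ?_⟩
  · rw [LinearEquiv.apply_symm_apply, exp_sdMatrix _ _ ha, exp_sdMatrix _ _ hb,
      exp_sdMatrix _ _ hvv, hv, sdMatrix_smul, smul_smul, mul_inv_cancel₀ hS, one_smul]
    simp only [add_mul, mul_add, smul_mul_assoc, mul_smul_comm, one_mul, mul_one, sdMatrix_mul,
      sdMatrix_add, sdMatrix_smul, hab, Complex.cosh_add, sinh_eq_SH_mul]
    module
  · rw [hasEigenvalues_iff, LinearEquiv.apply_symm_apply, hadd, hvv]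

/-! ### Spinors -/

/-- The spinor representation `½ z · σ` of the two-form with complex vector `z`. -/
def spin (z : Fin 3 → ℂ) : Matrix (Fin 2) (Fin 2) ℂ :=
  (1 / 2 : ℂ) • !![z 2, z 0 - Complex.I * z 1; z 0 + Complex.I * z 1, -z 2]

/-- The Hermitian matrix `v⁰ + v · σ` of a vector; its determinant is `(v,v)`. -/
def herm (v : Vec) : Matrix (Fin 2) (Fin 2) ℂ :=
  !![(v 0 : ℂ) + v 3, (v 1 : ℂ) - Complex.I * v 2; (v 1 : ℂ) + Complex.I * v 2, (v 0 : ℂ) - v 3]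

theorem ip_eq (x y : Vec) : ip x y = x 0 * y 0 - x 1 * y 1 - x 2 * y 2 - x 3 * y 3 := by
  simp [ip, eta, dotProduct, Fin.sum_univ_four, Matrix.mulVec_diagonal]
  ring

theorem det_herm (v : Vec) : (herm v).det = (ip v v : ℝ) := by
  rw [Matrix.det_fin_two, ip_eq]
  have hI : Complex.I ^ 2 = -1 := Complex.I_sq
  simp [herm]
  ring_nf
  rw [hI]
  ring

theorem herm_injective : Function.Injective herm := by
  intro v w h
  have h00 := congrFun (congrFun h 0) 0
  have h10 := congrFun (congrFun h 1) 0
  have h11 := congrFun (congrFun h 1) 1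
  simp [herm, Complex.ext_iff] at h00 h10 h11
  ext i
  fin_cases i
  · change v 0 = w 0; linarith
  · exact h10.1
  · exact h10.2
  · change v 3 = w 3; linarith

theorem herm_smul (r : ℝ) (v : Vec) : herm (r • v) = (r : ℂ) • herm v := by
  ext i j
  fin_cases i <;> fin_cases j <;> simp [herm] <;> ring

/-- The action of two-forms on vectors, in terms of spinors. -/
theorem herm_mulVec (F : TwoForm) (v : Vec) :
    herm (F.1 *ᵥ v) = spin (cvec F) * herm v + herm v * (spin (cvec F))ᴴ := by
  rw [val_eq F]
  ext i j
  simp only [Matrix.add_apply, Matrix.mul_apply, Fin.sum_univ_two, Matrix.conjTranspose_apply]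
  fin_cases i <;> fin_cases j <;>
    simp [herm, spin, fieldMatrix, Matrix.mulVec, dotProduct, Fin.sum_univ_four,
      Complex.ext_iff] <;> constructor <;> ring

theorem spin_smul (c : ℂ) (z : Fin 3 → ℂ) : spin (c • z) = c • spin z := by
  ext i j
  fin_cases i <;> fin_cases j <;> simp [spin] <;> ring

theorem spin_anticomm (z w : Fin 3 → ℂ) :
    spin z * spin w + spin w * spin z = ((z ⬝ᵥ w) / 2) • (1 : Matrix (Fin 2) (Fin 2) ℂ) := by
  have hI : Complex.I ^ 2 = -1 := Complex.I_sq
  ext i j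
  fin_cases i <;> fin_cases j <;>
    simp [spin, dotProduct, Fin.sum_univ_three] <;> ring_nf <;>
      simp only [hI] <;> ring

theorem spin_injective : Function.Injective spin := by
  intro z w h
  have h00 := congrFun (congrFun h 0) 0
  have h10 := congrFun (congrFun h 1) 0
  have h01 := congrFun (congrFun h 0) 1
  simp [spin] at h00 h10 h01
  ext i
  fin_cases i
  · change z 0 = w 0; linear_combination (h10 + h01) / 2
  · change z 1 = w 1
    apply mul_left_cancel₀ Complex.I_ne_zero
    linear_combination (h10 - h01) / 2
  · exact h00

theorem exists_smul_of_det_eq_zero {κ w : Fin 2 → ℂ} (hκ : κ ≠ 0)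
    (h : κ 0 * w 1 - κ 1 * w 0 = 0) : ∃ c : ℂ, w = c • κ := by
  by_cases h0 : κ 0 = 0
  · have h1 : κ 1 ≠ 0 := fun h1 => hκ (by ext i; fin_cases i <;> simp [h0, h1])
    refine ⟨w 1 / κ 1, ?_⟩
    have hw : w 0 = 0 := by simpa [h0, h1] using h
    ext i
    fin_cases i <;> simp [h0, h1, hw]
  · refine ⟨w 0 / κ 0, ?_⟩
    ext i
    fin_cases i
    · simp [h0]
    · simp
      field_simp
      linear_combination h

theorem exists_col_ne_zero {N : Matrix (Fin 2) (Fin 2) ℂ} (hN : N ≠ 0) :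
    ∃ e : Fin 2 → ℂ, N *ᵥ e ≠ 0 := by
  by_contra! h
  exact hN (Matrix.ext_of_mulVec_single fun i => by rw [h, Matrix.zero_mulVec])

/-- The image of a singular matrix is at most one-dimensional. -/
theorem exists_mulVec_eq_smul {N : Matrix (Fin 2) (Fin 2) ℂ} (hdet : N.det = 0)
    {e : Fin 2 → ℂ} (he : N *ᵥ e ≠ 0) (w : Fin 2 → ℂ) : ∃ c : ℂ, N *ᵥ w = c • (N *ᵥ e) := by
  apply exists_smul_of_det_eq_zero he
  rw [Matrix.det_fin_two] at hdet
  simp [Matrix.mulVec, dotProduct, Fin.sum_univ_two]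
  linear_combination (e 0 * w 1 - e 1 * w 0) * hdet

/-- If two elements of the spinor representation have a common eigenvector, the Gram determinant of
their vectors vanishes. -/
theorem gram_eq_zero_of_common_eigenvector {z w : Fin 3 → ℂ} {κ : Fin 2 → ℂ} (hκ : κ ≠ 0)
    {a b : ℂ} (ha : spin z *ᵥ κ = a • κ) (hb : spin w *ᵥ κ = b • κ) :
    (z ⬝ᵥ z) * (w ⬝ᵥ w) - (z ⬝ᵥ w) ^ 2 = 0 := by
  have key : ∀ {z w : Fin 3 → ℂ} {a b : ℂ}, spin z *ᵥ κ = a • κ → spin w *ᵥ κ = b • κ →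
      z ⬝ᵥ w = 4 * (a * b) := by
    intro z w a b ha hb
    have h := congrArg (· *ᵥ κ) (spin_anticomm z w)
    simp only [Matrix.add_mulVec, ← Matrix.mulVec_mulVec, ha, hb, Matrix.mulVec_smul, smul_smul,
      Matrix.smul_mulVec, Matrix.one_mulVec, ← add_smul] at h
    have := smul_left_injective ℂ hκ h
    linear_combination (-2) * this
  rw [key ha ha, key hb hb, key ha hb]
  ring

theorem eigenvalue_sq {z : Fin 3 → ℂ} {κ : Fin 2 → ℂ} (hκ : κ ≠ 0) {a : ℂ}
    (ha : spin z *ᵥ κ = a • κ) : z ⬝ᵥ z = 4 * a ^ 2 := by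
  have h := congrArg (· *ᵥ κ) (spin_anticomm z z)
  simp only [Matrix.add_mulVec, ← Matrix.mulVec_mulVec, ha, Matrix.mulVec_smul, smul_smul,
    Matrix.smul_mulVec, Matrix.one_mulVec, ← add_smul] at h
  have := smul_left_injective ℂ hκ h
  linear_combination (-2) * this

theorem exists_eigenvector (N : Matrix (Fin 2) (Fin 2) ℂ) :
    ∃ κ : Fin 2 → ℂ, κ ≠ 0 ∧ ∃ a : ℂ, N *ᵥ κ = a • κ := by
  obtain ⟨a, ha⟩ := Module.End.exists_eigenvalue (Matrix.toLin' N)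
  obtain ⟨κ, hκ⟩ := ha.exists_hasEigenvector
  exact ⟨κ, hκ.2, a, by simpa using hκ.apply_eq_smul⟩

/-- If the Gram determinant vanishes, the commutator of the two spinor matrices is nilpotent. A
nonzero commutator anticommutes with both of them, so that they preserve its kernel; if the
commutator is zero they are proportional. -/
theorem exists_common_eigenvector {z w : Fin 3 → ℂ} (hz : z ≠ 0)
    (h : (z ⬝ᵥ z) * (w ⬝ᵥ w) - (z ⬝ᵥ w) ^ 2 = 0) :
    ∃ κ : Fin 2 → ℂ, κ ≠ 0 ∧ ∃ a b : ℂ, spin z *ᵥ κ = a • κ ∧ spin w *ᵥ κ = b • κ := by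
  by_cases hc : z ⨯₃ w = 0
  · obtain ⟨κ, hκ, a, ha⟩ := exists_eigenvector (spin z)
    obtain ⟨c, rfl⟩ : ∃ c : ℂ, w = c • z := by
      have h0 := congrFun hc 0
      have h1 := congrFun hc 1
      have h2 := congrFun hc 2
      simp [cross_apply] at h0 h1 h2
      obtain ⟨i, hi⟩ := Function.ne_iff.1 hz
      simp at hi
      refine ⟨w i / z i, ?_⟩
      ext j
      fin_cases i <;> fin_cases j <;> simp at hi ⊢ <;> field_simp
      · linear_combination h2
      · linear_combination -h1
      · linear_combination -h2
      · linear_combination h0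
      · linear_combination h1
      · linear_combination -h0
    exact ⟨κ, hκ, a, c * a, ha, by rw [spin_smul, Matrix.smul_mulVec, ha, smul_smul]⟩
  · set N := spin (z ⨯₃ w) with hN
    have hN0 : N ≠ 0 := fun h0 => hc (spin_injective (by
      rw [← hN, h0]; ext i j; fin_cases i <;> fin_cases j <;> simp [spin]))
    have hcc : (z ⨯₃ w) ⬝ᵥ (z ⨯₃ w) = 0 := by
      rw [cross_dot_cross, dotProduct_comm w z]
      linear_combination h
    have hNN : N * N = 0 := by
      have := spin_anticomm (z ⨯₃ w) (z ⨯₃ w)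
      rw [hcc, zero_div, zero_smul, ← two_smul ℂ] at this
      exact (smul_eq_zero.1 this).resolve_left two_ne_zero
    obtain ⟨e, he⟩ := exists_col_ne_zero hN0
    have hker : N *ᵥ (N *ᵥ e) = 0 := by rw [Matrix.mulVec_mulVec, hNN, Matrix.zero_mulVec]
    have step : ∀ u : Fin 3 → ℂ, u ⬝ᵥ (z ⨯₃ w) = 0 →
        ∃ a : ℂ, spin u *ᵥ (N *ᵥ e) = a • (N *ᵥ e) := by
      intro u hu
      have hanti := spin_anticomm u (z ⨯₃ w)
      rw [hu, zero_div, zero_smul, ← hN] at hanti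
      have h1 : spin u * N = N * -spin u := by
        rw [Matrix.mul_neg]
        exact eq_neg_of_add_eq_zero_left hanti
      have hdet : N.det = 0 := by
        have := congrArg Matrix.det hNN
        simpa using this
      rw [Matrix.mulVec_mulVec, h1, ← Matrix.mulVec_mulVec]
      exact exists_mulVec_eq_smul hdet he _
    obtain ⟨a, ha⟩ := step z (dot_self_cross _ _)
    obtain ⟨b, hb⟩ := step w (dot_cross_self _ _)
    exact ⟨N *ᵥ e, he, a, b, ha, hb⟩

/-- The null vector with spinor `κ`. -/
def nullVec (κ : Fin 2 → ℂ) : Vec :=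
  ![(Complex.normSq (κ 0) + Complex.normSq (κ 1)) / 2, (κ 0 * starRingEnd ℂ (κ 1)).re,
    -(κ 0 * starRingEnd ℂ (κ 1)).im, (Complex.normSq (κ 0) - Complex.normSq (κ 1)) / 2]

theorem herm_nullVec (κ : Fin 2 → ℂ) : herm (nullVec κ) = vecMulVec κ (Star.star κ) := by
  ext i j
  fin_cases i <;> fin_cases j <;>
    simp [herm, nullVec, vecMulVec_apply, Complex.ext_iff, Complex.normSq_apply] <;>
      constructor <;> ring

theorem herm_mulVec_nullVec {F : TwoForm} {κ : Fin 2 → ℂ} {a : ℂ}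
    (h : spin (cvec F) *ᵥ κ = a • κ) : F.1 *ᵥ nullVec κ = (2 * a.re) • nullVec κ := by
  apply herm_injective
  rw [herm_mulVec, herm_smul, herm_nullVec, Matrix.mul_vecMulVec, h, Matrix.vecMulVec_mul,
    ← Matrix.star_mulVec, h]
  rw [star_smul, Matrix.smul_vecMulVec, Matrix.vecMulVec_smul, ← add_smul]
  congr 1
  simp [Complex.ext_iff]
  ring

theorem normSq_add_pos {κ : Fin 2 → ℂ} (hκ : κ ≠ 0) :
    0 < Complex.normSq (κ 0) + Complex.normSq (κ 1) := by
  by_contra! hle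
  have h0 := Complex.normSq_nonneg (κ 0)
  have h1 := Complex.normSq_nonneg (κ 1)
  apply hκ
  ext i
  fin_cases i
  · exact Complex.normSq_eq_zero.1 (le_antisymm (by change Complex.normSq (κ 0) ≤ 0; linarith) h0)
  · exact Complex.normSq_eq_zero.1 (le_antisymm (by change Complex.normSq (κ 1) ≤ 0; linarith) h1)

theorem nullVec_ne_zero {κ : Fin 2 → ℂ} (hκ : κ ≠ 0) : nullVec κ ≠ 0 := by
  intro h
  have := congrFun h 0
  have hp := normSq_add_pos hκ
  simp [nullVec] at this
  linarith

theorem ip_nullVec (κ : Fin 2 → ℂ) : ip (nullVec κ) (nullVec κ) = 0 := by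
  rw [ip_eq]
  simp [nullVec, Complex.normSq_apply]
  ring

/-- A null tetrad whose first vector belongs to a given spinor `κ`; the others are built from
`κ` and the orthogonal spinor `(-κ₁*, κ₀*)`. -/
theorem exists_nullTetrad {κ : Fin 2 → ℂ} (hκ : κ ≠ 0) : ∃ T : NullTetrad, T.l = nullVec κ := by
  have hp := (normSq_add_pos hκ).ne'
  have e1 : Complex.normSq (κ 0) = (κ 0).re * (κ 0).re + (κ 0).im * (κ 0).im :=
    Complex.normSq_apply _
  have e2 : Complex.normSq (κ 1) = (κ 1).re * (κ 1).re + (κ 1).im * (κ 1).im :=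
    Complex.normSq_apply _
  rw [e1, e2] at hp
  have hl : nullVec κ = ![((κ 0).re * (κ 0).re + (κ 0).im * (κ 0).im +
      ((κ 1).re * (κ 1).re + (κ 1).im * (κ 1).im)) / 2,
      (κ 0).re * (κ 1).re + (κ 0).im * (κ 1).im, (κ 0).re * (κ 1).im - (κ 0).im * (κ 1).re,
      ((κ 0).re * (κ 0).re + (κ 0).im * (κ 0).im -
      ((κ 1).re * (κ 1).re + (κ 1).im * (κ 1).im)) / 2] := by
    ext i
    fin_cases i <;> simp [nullVec, e1, e2]
    ring
  rw [hl]
  generalize (κ 0).re = a at *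
  generalize (κ 0).im = b at *
  generalize (κ 1).re = c at *
  generalize (κ 1).im = d at *
  obtain ⟨r, hr⟩ : ∃ r : ℝ, r * (a * a + b * b + (c * c + d * d)) = 1 :=
    ⟨_, inv_mul_cancel₀ hp⟩
  refine ⟨{
    l := ![(a * a + b * b + (c * c + d * d)) / 2, a * c + b * d, a * d - b * c,
      (a * a + b * b - (c * c + d * d)) / 2]
    m := (2 * r ^ 2) • ![(a * a + b * b + (c * c + d * d)) / 2, -(a * c + b * d),
      -(a * d - b * c), -((a * a + b * b - (c * c + d * d)) / 2)]
    p := r • ![0, a * a - b * b - (c * c - d * d), -(2 * a * b + 2 * c * d),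
      -2 * (a * c - b * d)]
    q := r • ![0, 2 * a * b - 2 * c * d, a * a - b * b + (c * c - d * d),
      -2 * (a * d + b * c)]
    ll := ?_, mm := ?_, lp := ?_, lq := ?_, mp := ?_, mq := ?_, pq := ?_, lm := ?_, pp := ?_,
    qq := ?_ }, rfl⟩
  case refine_8 =>
    rw [ip_eq]
    simp
    linear_combination (r * (a * a + b * b + (c * c + d * d)) + 1) * hr
  case refine_9 | refine_10 =>
    rw [ip_eq]
    simp
    linear_combination (-(r * (a * a + b * b + (c * c + d * d))) - 1) * hr
  all_goals
    rw [ip_eq]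
    simp
    ring

/-! ### The plane of a unitary or null two-form -/

/-- A simple two-form `U` satisfies `*U U = 0`. -/
theorem star_mulVec_eq_zero_of_mem_plane {U : TwoForm} (him : (cvec U ⬝ᵥ cvec U).im = 0)
    {v : Vec} (hv : v ∈ plane U) : (star U).1 *ᵥ v = 0 := by
  obtain ⟨w, rfl⟩ := hv
  rw [val_eq (star U), cvec_star, Matrix.toLin'_apply, val_eq U]
  simp [dotProduct, Fin.sum_univ_three] at him
  ext i
  fin_cases i <;>
    simp [fieldMatrix, Matrix.mulVec, dotProduct, Fin.sum_univ_four]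
  · linear_combination (-w 0 / 2) * him
  · linear_combination (-w 1 / 2) * him
  · linear_combination (-w 2 / 2) * him
  · linear_combination (-w 3 / 2) * him

/-- The kernel of the dual of a two-form `U` with nonzero electric part is spanned by the images of
the time axis under `U` and `U²`. -/
theorem exists_eq_of_star_mulVec_eq_zero {U : TwoForm}
    (hre : 0 < (cvec U 0).re ^ 2 + (cvec U 1).re ^ 2 + (cvec U 2).re ^ 2) {v : Vec}
    (h : (star U).1 *ᵥ v = 0) :
    ∃ s t : ℝ, v = s • (U.1 *ᵥ ![1, 0, 0, 0]) + t • (U.1 *ᵥ (U.1 *ᵥ ![1, 0, 0, 0])) := by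
  rw [val_eq (star U), cvec_star] at h
  rw [val_eq U]
  have h0 := congrFun h 0
  have h1 := congrFun h 1
  have h2 := congrFun h 2
  have h3 := congrFun h 3
  simp [fieldMatrix, Matrix.mulVec, dotProduct, Fin.sum_univ_four] at h0 h1 h2 h3
  refine ⟨(v 1 * (cvec U 0).re + v 2 * (cvec U 1).re + v 3 * (cvec U 2).re) /
    ((cvec U 0).re ^ 2 + (cvec U 1).re ^ 2 + (cvec U 2).re ^ 2),
    v 0 / ((cvec U 0).re ^ 2 + (cvec U 1).re ^ 2 + (cvec U 2).re ^ 2), ?_⟩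
  have hne := hre.ne'
  ext i
  fin_cases i <;>
    simp [fieldMatrix, dotProduct, Fin.sum_univ_four] <;>
    field_simp
  · linear_combination (cvec U 1).re * h3 - (cvec U 2).re * h2
  · linear_combination (cvec U 2).re * h1 - (cvec U 0).re * h3
  · linear_combination (cvec U 0).re * h2 - (cvec U 1).re * h1

/-- The two-form `U` is nonzero and simple, and its plane is timelike or null. -/
def IsUnitaryOrNull (U : TwoForm) : Prop :=
  U ≠ 0 ∧ (cvec U ⬝ᵥ cvec U = 1 ∨ cvec U ⬝ᵥ cvec U = 0)

theorem HasGeometry.isUnitaryOrNull {F U : TwoForm} (h : HasGeometry F U) :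
    IsUnitaryOrNull U := by
  obtain ⟨hF, ⟨-, hU, -⟩ | ⟨hF', rfl⟩⟩ := h
  · rw [isUnitary_iff] at hU
    refine ⟨?_, Or.inl hU⟩
    rintro rfl
    simp at hU
  · exact ⟨hF, Or.inr ((isSingular_iff _).1 hF')⟩

theorem HasGeometry.exists_smul {F U : TwoForm} (h : HasGeometry F U) :
    ∃ c : ℂ, c ≠ 0 ∧ cvec F = c • cvec U := by
  obtain ⟨hF, ⟨-, hU, α, α', rfl⟩ | ⟨hF', rfl⟩⟩ := h
  · rw [cvec_smul_sub_smul_star]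
    refine ⟨_, ?_, rfl⟩
    intro h0
    apply hF
    apply cvec.injective
    rw [cvec_smul_sub_smul_star, h0, zero_smul, map_zero]
  · exact ⟨1, one_ne_zero, by rw [one_smul]⟩

namespace IsUnitaryOrNull

variable {U : TwoForm}

theorem im_eq_zero (hU : IsUnitaryOrNull U) : (cvec U ⬝ᵥ cvec U).im = 0 := by
  rcases hU.2 with h | h <;> simp [h]

theorem re_nonneg (hU : IsUnitaryOrNull U) : 0 ≤ (cvec U ⬝ᵥ cvec U).re := by
  rcases hU.2 with h | h <;> simp [h]

theorem electric_pos (hU : IsUnitaryOrNull U) :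
    0 < (cvec U 0).re ^ 2 + (cvec U 1).re ^ 2 + (cvec U 2).re ^ 2 := by
  have hre := hU.re_nonneg
  simp [dotProduct, Fin.sum_univ_three] at hre
  by_contra! hle
  have e0 : (cvec U 0).re = 0 := by nlinarith
  have e1 : (cvec U 1).re = 0 := by nlinarith
  have e2 : (cvec U 2).re = 0 := by nlinarith
  simp only [e0, e1, e2] at hre
  have b0 : (cvec U 0).im = 0 := by nlinarith
  have b1 : (cvec U 1).im = 0 := by nlinarith
  have b2 : (cvec U 2).im = 0 := by nlinarith
  apply hU.1
  apply cvec.injective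
  ext i
  rw [map_zero]
  fin_cases i <;> simp [Complex.ext_iff, *]

theorem mem_plane_iff (hU : IsUnitaryOrNull U) (v : Vec) : v ∈ plane U ↔ (star U).1 *ᵥ v = 0 := by
  refine ⟨star_mulVec_eq_zero_of_mem_plane hU.im_eq_zero, fun h => ?_⟩
  obtain ⟨s, t, rfl⟩ := exists_eq_of_star_mulVec_eq_zero hU.electric_pos h
  exact ⟨s • ![1, 0, 0, 0] + t • (U.1 *ᵥ ![1, 0, 0, 0]), by
    rw [Matrix.toLin'_apply, Matrix.mulVec_add, Matrix.mulVec_smul, Matrix.mulVec_smul]⟩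

theorem plane_eq_span (hU : IsUnitaryOrNull U) :
    plane U = Submodule.span ℝ {U.1 *ᵥ ![1, 0, 0, 0], U.1 *ᵥ (U.1 *ᵥ ![1, 0, 0, 0])} := by
  ext v
  rw [Submodule.mem_span_pair]
  constructor
  · intro h
    obtain ⟨s, t, rfl⟩ := exists_eq_of_star_mulVec_eq_zero hU.electric_pos
      (star_mulVec_eq_zero_of_mem_plane hU.im_eq_zero h)
    exact ⟨s, t, rfl⟩
  · rintro ⟨s, t, rfl⟩
    exact ⟨s • ![1, 0, 0, 0] + t • (U.1 *ᵥ ![1, 0, 0, 0]), by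
      rw [Matrix.toLin'_apply, Matrix.mulVec_add, Matrix.mulVec_smul, Matrix.mulVec_smul]⟩

/-- A null direction of the plane of `U` is an eigendirection of `U` in the spinor sense: the image
of the Hermitian matrix of a null vector is a line of eigenvectors. -/
theorem exists_spin_mulVec_eq (hU : IsUnitaryOrNull U) {x : Vec} (hx : ip x x = 0)
    (hxU : x ∈ plane U) {e : Fin 2 → ℂ}
    (he : herm x *ᵥ e ≠ 0) : ∃ a : ℂ, spin (cvec U) *ᵥ (herm x *ᵥ e) = a • (herm x *ᵥ e) := by
  have h := herm_mulVec (star U) x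
  rw [(hU.mem_plane_iff x).1 hxU, cvec_star, spin_smul, Matrix.conjTranspose_smul] at h
  have h0 : herm 0 = 0 := by ext i j; fin_cases i <;> fin_cases j <;> simp [herm]
  rw [h0] at h
  have h1 : spin (cvec U) * herm x = herm x * (spin (cvec U))ᴴ := by
    have h2 : Complex.I • (spin (cvec U) * herm x - herm x * (spin (cvec U))ᴴ) = 0 := by
      rw [h]
      simp [sub_eq_add_neg]
    exact sub_eq_zero.1 ((smul_eq_zero.1 h2).resolve_left Complex.I_ne_zero)
  have hdet : (herm x).det = 0 := by rw [det_herm, hx, Complex.ofReal_zero]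
  rw [Matrix.mulVec_mulVec, h1, ← Matrix.mulVec_mulVec]
  exact exists_mulVec_eq_smul hdet he _

/-- The null vector of an eigenspinor of `U` lies in the plane of `U`. -/
theorem nullVec_mem_plane (hU : IsUnitaryOrNull U) {κ : Fin 2 → ℂ} (hκ : κ ≠ 0) {a : ℂ}
    (ha : spin (cvec U) *ᵥ κ = a • κ) : nullVec κ ∈ plane U := by
  have hre : a.im = 0 := by
    have hq := eigenvalue_sq hκ ha
    rcases hU.2 with h | h <;> rw [h] at hq
    · have : (2 * a - 1) * (2 * a + 1) = 0 := by linear_combination -hq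
      rcases mul_eq_zero.1 this with h1 | h1
      · have := congrArg Complex.im h1; simpa using this
      · have := congrArg Complex.im h1; simpa using this
    · have : a = 0 := by simpa using hq.symm
      simp [this]
  rw [hU.mem_plane_iff]
  have hs : spin (cvec (star U)) *ᵥ κ = (Complex.I * a) • κ := by
    rw [cvec_star, spin_smul, Matrix.smul_mulVec, ha, smul_smul]
  rw [herm_mulVec_nullVec hs]
  simp [hre]

end IsUnitaryOrNull

/-- Two planes share a null direction exactly if the spinor matrices share an eigenvector. -/
theorem shareNullDirection_iff {F G U V : TwoForm} (hU : HasGeometry F U) (hV : HasGeometry G V) :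
    ShareNullDirection (plane U) (plane V) ↔ gram F G = 0 := by
  obtain ⟨c, hc, hFU⟩ := hU.exists_smul
  obtain ⟨d, hd, hGV⟩ := hV.exists_smul
  have hU' := hU.isUnitaryOrNull
  have hV' := hV.isUnitaryOrNull
  have hgram : gram F G = (c * d) ^ 2 * gram U V := by
    simp only [gram, hFU, hGV, smul_dotProduct, dotProduct_smul, smul_eq_mul]
    ring
  rw [hgram, mul_eq_zero, or_iff_right (pow_ne_zero 2 (mul_ne_zero hc hd))]
  constructor
  · rintro ⟨x, hx0, hx, hxU, hxV⟩
    have hne : herm x ≠ 0 := fun h0 => hx0 (herm_injective (by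
      rw [h0]; ext i j; fin_cases i <;> fin_cases j <;> simp [herm]))
    obtain ⟨e, he⟩ := exists_col_ne_zero hne
    obtain ⟨a, ha⟩ := hU'.exists_spin_mulVec_eq hx hxU he
    obtain ⟨b, hb⟩ := hV'.exists_spin_mulVec_eq hx hxV he
    exact gram_eq_zero_of_common_eigenvector he ha hb
  · intro h
    obtain ⟨κ, hκ, a, b, ha, hb⟩ := exists_common_eigenvector
      (fun h0 => hU'.1 (cvec.injective (by rw [h0, map_zero]))) h
    exact ⟨nullVec κ, nullVec_ne_zero hκ, ip_nullVec κ, hU'.nullVec_mem_plane hκ ha,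
      hV'.nullVec_mem_plane hκ hb⟩

/-- If the Gram determinant vanishes, some null tetrad has a first vector which is a common
eigenvector of both two-forms. -/
theorem exists_nullTetrad_of_gram_eq_zero {F G : TwoForm} (hF : F ≠ 0) (h : gram F G = 0) :
    ∃ T : NullTetrad, (∃ r : ℝ, F.1 *ᵥ T.l = r • T.l) ∧ ∃ r : ℝ, G.1 *ᵥ T.l = r • T.l := by
  obtain ⟨κ, hκ, a, b, ha, hb⟩ := exists_common_eigenvector
    (fun h0 => hF (cvec.injective (by rw [h0, map_zero]))) h
  obtain ⟨T, hT⟩ := exists_nullTetrad hκ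
  exact ⟨T, ⟨_, by rw [hT]; exact herm_mulVec_nullVec ha⟩,
    ⟨_, by rw [hT]; exact herm_mulVec_nullVec hb⟩⟩

/-! ### Null tetrads and the stabilizer of a null direction -/

theorem ip_comm (x y : Vec) : ip x y = ip y x := by
  rw [ip_eq, ip_eq]; ring

theorem ip_add_left (x y z : Vec) : ip (x + y) z = ip x z + ip y z := by
  simp only [ip_eq, Pi.add_apply]; ring

theorem ip_add_right (x y z : Vec) : ip x (y + z) = ip x y + ip x z := by
  simp only [ip_eq, Pi.add_apply]; ring

theorem ip_smul_left (r : ℝ) (x y : Vec) : ip (r • x) y = r * ip x y := by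
  simp only [ip_eq, Pi.smul_apply, smul_eq_mul]; ring

theorem ip_smul_right (r : ℝ) (x y : Vec) : ip x (r • y) = r * ip x y := by
  simp only [ip_eq, Pi.smul_apply, smul_eq_mul]; ring

theorem ip_mulVec_left (F : TwoForm) (x y : Vec) : ip (F.1 *ᵥ x) y = -ip x (F.1 *ᵥ y) := by
  rw [val_eq F, ip_eq, ip_eq]
  simp [fieldMatrix, Matrix.mulVec, dotProduct, Fin.sum_univ_four]
  ring

theorem wedge_mulVec (x y v : Vec) : (wedge x y).1 *ᵥ v = ip y v • x - ip x v • y := by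
  rw [wedge, ← Matrix.mulVec_mulVec, Matrix.sub_mulVec, Matrix.vecMulVec_mulVec,
    Matrix.vecMulVec_mulVec]
  simp [ip]

theorem twoForm_ext {F G : TwoForm} (h : ∀ v, F.1 *ᵥ v = G.1 *ᵥ v) : F = G :=
  Subtype.ext (Matrix.ext_of_mulVec_single fun _ => h _)

theorem coe_add_mulVec (F G : TwoForm) (v : Vec) :
    (F + G).1 *ᵥ v = F.1 *ᵥ v + G.1 *ᵥ v := Matrix.add_mulVec F.1 G.1 v

theorem coe_smul_mulVec (r : ℝ) (F : TwoForm) (v : Vec) : (r • F).1 *ᵥ v = r • (F.1 *ᵥ v) :=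
  Matrix.smul_mulVec r F.1 v

theorem wedge_add_left (x y z : Vec) : wedge (x + y) z = wedge x z + wedge y z :=
  twoForm_ext fun v => by
    simp only [coe_add_mulVec, wedge_mulVec, ip_add_left]; module

theorem wedge_add_right (x y z : Vec) : wedge x (y + z) = wedge x y + wedge x z :=
  twoForm_ext fun v => by
    simp only [coe_add_mulVec, wedge_mulVec, ip_add_left]; module

theorem wedge_smul_left (r : ℝ) (x y : Vec) : wedge (r • x) y = r • wedge x y :=
  twoForm_ext fun v => by
    simp only [coe_smul_mulVec, wedge_mulVec, ip_smul_left]; module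

theorem wedge_smul_right (r : ℝ) (x y : Vec) : wedge x (r • y) = r • wedge x y :=
  twoForm_ext fun v => by
    simp only [coe_smul_mulVec, wedge_mulVec, ip_smul_left]; module

theorem wedge_self (x : Vec) : wedge x x = 0 :=
  twoForm_ext fun v => by
    rw [wedge_mulVec, sub_self]; exact (Matrix.zero_mulVec v).symm

theorem wedge_swap (x y : Vec) : wedge y x = -wedge x y := by
  have h := wedge_self (x + y)
  rw [wedge_add_left, wedge_add_right, wedge_add_right, wedge_self, wedge_self, zero_add,
    add_zero] at h
  exact eq_neg_of_add_eq_zero_right h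

/-- Two-forms act on bivectors by derivations. -/
theorem lie_wedge (F : TwoForm) (x y : Vec) :
    ⁅F, wedge x y⁆ = wedge (F.1 *ᵥ x) y + wedge x (F.1 *ᵥ y) :=
  twoForm_ext fun v => by
    rw [lie_val, Matrix.sub_mulVec, ← Matrix.mulVec_mulVec, ← Matrix.mulVec_mulVec,
      coe_add_mulVec]
    simp only [wedge_mulVec, Matrix.mulVec_sub, Matrix.mulVec_smul, ip_mulVec_left]
    module

namespace NullTetrad

variable (T : NullTetrad)

/-- The two-form with complex coordinates `x + iy` along `A1`, `A2` and `s + it` along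
`A3`, `A4`. -/
def el (x y s t : ℝ) : TwoForm := x • T.A1 + y • T.A2 + s • T.A3 + t • T.A4

theorem ml : ip T.m T.l = 1 := by rw [ip_comm, T.lm]
theorem pl : ip T.p T.l = 0 := by rw [ip_comm, T.lp]
theorem ql : ip T.q T.l = 0 := by rw [ip_comm, T.lq]
theorem pm : ip T.p T.m = 0 := by rw [ip_comm, T.mp]
theorem qm : ip T.q T.m = 0 := by rw [ip_comm, T.mq]
theorem qp : ip T.q T.p = 0 := by rw [ip_comm, T.pq]

theorem el_mulVec_l (x y s t : ℝ) : (T.el x y s t).1 *ᵥ T.l = x • T.l := by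
  simp only [el, A1, A2, A3, A4, coe_add_mulVec, coe_smul_mulVec, wedge_mulVec, T.ll, T.ml, T.pl,
    T.ql]
  module

theorem el_mulVec_m (x y s t : ℝ) :
    (T.el x y s t).1 *ᵥ T.m = -x • T.m - s • T.p - t • T.q := by
  simp only [el, A1, A2, A3, A4, coe_add_mulVec, coe_smul_mulVec, wedge_mulVec, T.lm, T.mm, T.pm,
    T.qm]
  module

theorem el_mulVec_p (x y s t : ℝ) : (T.el x y s t).1 *ᵥ T.p = y • T.q - s • T.l := by
  simp only [el, A1, A2, A3, A4, coe_add_mulVec, coe_smul_mulVec, wedge_mulVec, T.lp, T.mp, T.pp,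
    T.qp]
  module

theorem el_mulVec_q (x y s t : ℝ) : (T.el x y s t).1 *ᵥ T.q = -y • T.p - t • T.l := by
  simp only [el, A1, A2, A3, A4, coe_add_mulVec, coe_smul_mulVec, wedge_mulVec, T.lq, T.mq, T.pq,
    T.qq]
  module

theorem el_add (x y s t x' y' s' t' : ℝ) :
    T.el x y s t + T.el x' y' s' t' = T.el (x + x') (y + y') (s + s') (t + t') := by
  simp only [el]; module

theorem smul_el (r x y s t : ℝ) : r • T.el x y s t = T.el (r * x) (r * y) (r * s) (r * t) := by
  simp only [el]; module

theorem A1_eq : T.A1 = T.el 1 0 0 0 := by simp only [el]; module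
theorem A2_eq : T.A2 = T.el 0 1 0 0 := by simp only [el]; module
theorem A3_eq : T.A3 = T.el 0 0 1 0 := by simp only [el]; module
theorem A4_eq : T.A4 = T.el 0 0 0 1 := by simp only [el]; module
theorem el_zero : T.el 0 0 0 0 = 0 := by simp only [el]; module

/-- In complex coordinates `(h, n)` the bracket is `[(h, n), (h', n')] = (0, h n' - h' n)`. -/
theorem lie_el (x y s t x' y' s' t' : ℝ) :
    ⁅T.el x y s t, T.el x' y' s' t'⁆ =
      T.el 0 0 (x * s' - y * t' - (x' * s - y' * t)) (x * t' + y * s' - (x' * t + y' * s)) := by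
  have h : ∀ X : TwoForm, ⁅X, T.el x' y' s' t'⁆ =
      x' • (wedge (X.1 *ᵥ T.l) T.m + wedge T.l (X.1 *ᵥ T.m)) +
      y' • (wedge (X.1 *ᵥ T.p) T.q + wedge T.p (X.1 *ᵥ T.q)) +
      s' • (wedge (X.1 *ᵥ T.l) T.p + wedge T.l (X.1 *ᵥ T.p)) +
      t' • (wedge (X.1 *ᵥ T.l) T.q + wedge T.l (X.1 *ᵥ T.q)) := fun X => by
    simp only [el, A1, A2, A3, A4, lie_add, lie_smul, lie_wedge]
  rw [h]
  simp only [el_mulVec_l, el_mulVec_m, el_mulVec_p, el_mulVec_q, sub_eq_add_neg, ← neg_smul,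
    wedge_add_left, wedge_add_right, wedge_smul_left, wedge_smul_right, wedge_self,
    wedge_swap T.l T.p]
  simp only [el, A1, A2, A3, A4]
  module

/-- The stabilizer of the null direction of `l`, a Borel subalgebra of the Lorentz algebra. -/
def borel : LieSubalgebra ℝ TwoForm where
  carrier := {F | ∃ x y s t, F = T.el x y s t}
  add_mem' := by
    rintro _ _ ⟨x, y, s, t, rfl⟩ ⟨x', y', s', t', rfl⟩
    exact ⟨_, _, _, _, T.el_add ..⟩
  zero_mem' := ⟨0, 0, 0, 0, T.el_zero.symm⟩
  smul_mem' := by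
    rintro r _ ⟨x, y, s, t, rfl⟩
    exact ⟨_, _, _, _, T.smul_el ..⟩
  lie_mem' := by
    rintro _ _ ⟨x, y, s, t, rfl⟩ ⟨x', y', s', t', rfl⟩
    exact ⟨_, _, _, _, T.lie_el ..⟩

theorem el_mem_borel (x y s t : ℝ) : T.el x y s t ∈ T.borel := ⟨x, y, s, t, rfl⟩

theorem borel_metabelian {a b c d : TwoForm} (ha : a ∈ T.borel) (hb : b ∈ T.borel)
    (hc : c ∈ T.borel) (hd : d ∈ T.borel) : ⁅⁅a, b⁆, ⁅c, d⁆⁆ = 0 := by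
  obtain ⟨_, _, _, _, rfl⟩ := ha
  obtain ⟨_, _, _, _, rfl⟩ := hb
  obtain ⟨_, _, _, _, rfl⟩ := hc
  obtain ⟨_, _, _, _, rfl⟩ := hd
  rw [lie_el, lie_el, lie_el, ← T.el_zero]
  congr 1 <;> ring

/-- The expansion of a vector along a null tetrad. -/
theorem expand (w : Vec) :
    w = ip w T.m • T.l + ip w T.l • T.m - ip w T.p • T.p - ip w T.q • T.q := by
  set E : Matrix (Fin 4) (Fin 4) ℝ := Matrix.of ![T.l, T.m, T.p, T.q] with hE
  set E' : Matrix (Fin 4) (Fin 4) ℝ := Matrix.of ![T.m, T.l, -T.p, -T.q] with hE'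
  have hneg : ∀ x y : Vec, ip (-x) y = -ip x y := fun x y => by
    simp only [ip_eq, Pi.neg_apply]; ring
  -- The rows of `E'` are dual to those of `E`, and a left inverse is a right inverse.
  have h1 : (E' * eta) * Eᵀ = 1 := by
    have key : ∀ i j, ((E' * eta) * Eᵀ) i j =
        ip (![T.m, T.l, -T.p, -T.q] i) (![T.l, T.m, T.p, T.q] j) := fun i j => by
      rw [Matrix.mul_apply, ip_eq]
      simp [eta, hE, hE', Fin.sum_univ_four, Matrix.mul_diagonal]
      ring
    ext i j
    rw [key]
    fin_cases i <;> fin_cases j <;>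
      simp [hneg, T.ll, T.mm, T.lm, T.ml, T.lp, T.lq, T.mp, T.mq, T.pl, T.ql, T.pm, T.qm,
        T.pq, T.qp, T.pp, T.qq]
  have h2 : Eᵀ * (E' * eta) = 1 := mul_eq_one_comm.1 h1
  have h3 := congrArg (· *ᵥ w) h2
  simp only [← Matrix.mulVec_mulVec, Matrix.one_mulVec] at h3
  ext k
  rw [← congrFun h3 k]
  simp [hE, hE', eta, ip_eq, Matrix.mulVec, dotProduct,
    Fin.sum_univ_four, Matrix.transpose_apply]
  ring

/-- A two-form lies in the Borel subalgebra as soon as `l` is an eigenvector. -/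
theorem mem_borel_of_mulVec_l {F : TwoForm} {r : ℝ} (h : F.1 *ᵥ T.l = r • T.l) :
    F ∈ T.borel := by
  refine ⟨r, -ip (F.1 *ᵥ T.p) T.q, ip (F.1 *ᵥ T.m) T.p, ip (F.1 *ᵥ T.m) T.q, ?_⟩
  have hself : ∀ v, ip (F.1 *ᵥ v) v = 0 := fun v => by
    have h1 := ip_mulVec_left F v v
    rw [ip_comm v] at h1
    linarith
  have hswap : ∀ u v, ip (F.1 *ᵥ u) v = -ip (F.1 *ᵥ v) u := fun u v => by
    rw [ip_mulVec_left, ip_comm u]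
  apply twoForm_ext
  intro v
  have hm : F.1 *ᵥ T.m =
      -r • T.m - ip (F.1 *ᵥ T.m) T.p • T.p - ip (F.1 *ᵥ T.m) T.q • T.q := by
    conv_lhs => rw [T.expand (F.1 *ᵥ T.m)]
    rw [hself, hswap T.m T.l, h, ip_smul_left, T.lm]
    module
  have hp : F.1 *ᵥ T.p = -ip (F.1 *ᵥ T.p) T.q • T.q - ip (F.1 *ᵥ T.m) T.p • T.l := by
    conv_lhs => rw [T.expand (F.1 *ᵥ T.p)]
    rw [hself, hswap T.p T.l, hswap T.p T.m, h, ip_smul_left, T.lp]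
    module
  have hq : F.1 *ᵥ T.q = ip (F.1 *ᵥ T.p) T.q • T.p - ip (F.1 *ᵥ T.m) T.q • T.l := by
    conv_lhs => rw [T.expand (F.1 *ᵥ T.q)]
    rw [hself, hswap T.q T.l, hswap T.q T.m, hswap T.q T.p, h, ip_smul_left, T.lq]
    module
  generalize ip (F.1 *ᵥ T.p) T.q = y at *
  generalize ip (F.1 *ᵥ T.m) T.p = s at *
  generalize ip (F.1 *ᵥ T.m) T.q = t at *
  rw [T.expand v]
  simp only [Matrix.mulVec_add, Matrix.mulVec_sub, Matrix.mulVec_smul, el_mulVec_l, el_mulVec_m,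
    el_mulVec_p, el_mulVec_q, h]
  rw [hm, hp, hq]
  simp only [neg_neg]

/-- The null rotation about `l` with complex parameter `σ + iτ`. -/
def nullRot (σ τ : ℝ) : NullTetrad where
  l := T.l
  m := T.m + σ • T.p + τ • T.q + ((σ ^ 2 + τ ^ 2) / 2) • T.l
  p := T.p + σ • T.l
  q := T.q + τ • T.l
  ll := T.ll
  mm := by
    simp only [ip_add_left, ip_add_right, ip_smul_left, ip_smul_right, T.ll, T.mm, T.lm, T.ml,
      T.lp, T.lq, T.mp, T.mq, T.pl, T.ql, T.pm, T.qm, T.pq, T.qp, T.pp, T.qq]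
    ring
  lp := by simp only [ip_add_right, ip_smul_right, T.ll, T.lp]; ring
  lq := by simp only [ip_add_right, ip_smul_right, T.ll, T.lq]; ring
  mp := by
    simp only [ip_add_left, ip_add_right, ip_smul_left, ip_smul_right, T.ll, T.ml,
      T.lp, T.mp, T.pl, T.ql, T.qp, T.pp]
    ring
  mq := by
    simp only [ip_add_left, ip_add_right, ip_smul_left, ip_smul_right, T.ll, T.ml,
      T.lq, T.mq, T.pl, T.ql, T.pq, T.qq]
    ring
  pq := by
    simp only [ip_add_left, ip_add_right, ip_smul_left, ip_smul_right, T.ll, T.lq, T.pl, T.pq]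
    ring
  lm := by
    simp only [ip_add_right, ip_smul_right, T.ll, T.lm, T.lp, T.lq]
    ring
  pp := by
    simp only [ip_add_left, ip_add_right, ip_smul_left, ip_smul_right, T.ll, T.lp, T.pl, T.pp]
    ring
  qq := by
    simp only [ip_add_left, ip_add_right, ip_smul_left, ip_smul_right, T.ll, T.lq, T.ql, T.qq]
    ring

/-- The rotation of the spacelike vectors `p`, `q` by the angle with cosine `c` and sine `d`. -/
def rot (c d : ℝ) (h : c ^ 2 + d ^ 2 = 1) : NullTetrad where
  l := T.l
  m := T.m
  p := c • T.p + d • T.q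
  q := -d • T.p + c • T.q
  ll := T.ll
  mm := T.mm
  lm := T.lm
  lp := by simp only [ip_add_right, ip_smul_right, T.lp, T.lq]; ring
  lq := by simp only [ip_add_right, ip_smul_right, T.lp, T.lq]; ring
  mp := by simp only [ip_add_right, ip_smul_right, T.mp, T.mq]; ring
  mq := by simp only [ip_add_right, ip_smul_right, T.mp, T.mq]; ring
  pq := by
    simp only [ip_add_left, ip_add_right, ip_smul_left, ip_smul_right, T.pq, T.qp, T.pp, T.qq]
    ring
  pp := by
    simp only [ip_add_left, ip_add_right, ip_smul_left, ip_smul_right, T.pq, T.qp, T.pp, T.qq]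
    linear_combination -h
  qq := by
    simp only [ip_add_left, ip_add_right, ip_smul_left, ip_smul_right, T.pq, T.qp, T.pp, T.qq]
    linear_combination -h

theorem nullRot_A1 (σ τ : ℝ) : (T.nullRot σ τ).A1 = T.el 1 0 σ τ := by
  simp only [A1, nullRot, wedge_add_right, wedge_smul_right, wedge_self, el, A3, A4]
  module

theorem nullRot_A2 (σ τ : ℝ) : (T.nullRot σ τ).A2 = T.el 0 1 (-τ) σ := by
  simp only [A2, nullRot, wedge_add_left, wedge_smul_left, wedge_add_right, wedge_smul_right,
    wedge_self, el, A3, A4, wedge_swap T.l T.p]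
  module

theorem nullRot_A3 (σ τ : ℝ) : (T.nullRot σ τ).A3 = T.A3 := by
  simp only [A3, nullRot, wedge_add_right, wedge_smul_right, wedge_self]
  module

theorem nullRot_A4 (σ τ : ℝ) : (T.nullRot σ τ).A4 = T.A4 := by
  simp only [A4, nullRot, wedge_add_right, wedge_smul_right, wedge_self]
  module

theorem rot_A1 (c d : ℝ) (h : c ^ 2 + d ^ 2 = 1) : (T.rot c d h).A1 = T.A1 := rfl

theorem rot_A3 (c d : ℝ) (h : c ^ 2 + d ^ 2 = 1) :
    (T.rot c d h).A3 = c • T.A3 + d • T.A4 := by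
  simp only [A3, A4, rot, wedge_add_right, wedge_smul_right]

end NullTetrad

/-! ### Subalgebras of the Borel algebra generated by two elements -/

theorem left_mem_genAlg (F G : TwoForm) : F ∈ genAlg F G :=
  LieSubalgebra.subset_lieSpan (by simp)

theorem right_mem_genAlg (F G : TwoForm) : G ∈ genAlg F G :=
  LieSubalgebra.subset_lieSpan (by simp)

theorem genAlg_le {F G : TwoForm} {K : LieSubalgebra ℝ TwoForm} (hF : F ∈ K) (hG : G ∈ K) :
    genAlg F G ≤ K := by
  rw [genAlg, LieSubalgebra.lieSpan_le]
  rintro x (rfl | rfl)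
  · exact hF
  · exact hG

theorem genAlg_comm (F G : TwoForm) : genAlg F G = genAlg G F := by
  rw [genAlg, genAlg, Set.pair_comm]

/-- Cramer's rule in a subalgebra. -/
theorem mem_of_combinations_mem {K : LieSubalgebra ℝ TwoForm} {F G : TwoForm} {a b c d : ℝ}
    (h : a * d - b * c ≠ 0) (h1 : a • F + b • G ∈ K) (h2 : c • F + d • G ∈ K) :
    F ∈ K ∧ G ∈ K := by
  obtain ⟨i, hi⟩ : ∃ i : ℝ, i * (a * d - b * c) = 1 := ⟨_, inv_mul_cancel₀ h⟩
  have hF : (i * d) • (a • F + b • G) + (-(i * b)) • (c • F + d • G) = F := by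
    match_scalars
    · linear_combination hi
    · ring
  have hG : (-(i * c)) • (a • F + b • G) + (i * a) • (c • F + d • G) = G := by
    match_scalars
    · ring
    · linear_combination hi
  have h3 := add_mem (SMulMemClass.smul_mem (i * d) h1) (SMulMemClass.smul_mem (-(i * b)) h2)
  have h4 := add_mem (SMulMemClass.smul_mem (-(i * c)) h1) (SMulMemClass.smul_mem (i * a) h2)
  rw [hF] at h3
  rw [hG] at h4
  exact ⟨h3, h4⟩

/-- Replacing the generators by independent linear combinations does not change the algebra. -/
theorem genAlg_combination (F G : TwoForm) {a b c d : ℝ} (h : a * d - b * c ≠ 0) :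
    genAlg (a • F + b • G) (c • F + d • G) = genAlg F G := by
  apply le_antisymm
  · have hF := left_mem_genAlg F G
    have hG := right_mem_genAlg F G
    exact genAlg_le (add_mem (SMulMemClass.smul_mem _ hF) (SMulMemClass.smul_mem _ hG))
      (add_mem (SMulMemClass.smul_mem _ hF) (SMulMemClass.smul_mem _ hG))
  · obtain ⟨h1, h2⟩ := mem_of_combinations_mem h
      (left_mem_genAlg (a • F + b • G) (c • F + d • G)) (right_mem_genAlg _ _)
    exact genAlg_le h1 h2

/-- If the span of `S` contains the generators and is closed under the bracket, and `S` is contained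
in the algebra that they generate, then this algebra is the span of `S`. -/
theorem genAlg_toSubmodule_eq_span {F G : TwoForm} {S : Set TwoForm}
    (hF : F ∈ Submodule.span ℝ S) (hG : G ∈ Submodule.span ℝ S)
    (hlie : ∀ x ∈ S, ∀ y ∈ S, ⁅x, y⁆ ∈ Submodule.span ℝ S) (hS : ∀ x ∈ S, x ∈ genAlg F G) :
    (genAlg F G).toSubmodule = Submodule.span ℝ S := by
  apply le_antisymm
  · let K : LieSubalgebra ℝ TwoForm :=
      { Submodule.span ℝ S with
        lie_mem' := by
          intro x y hx hy
          induction hx, hy using Submodule.span_induction₂ with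
          | mem_mem x y hx hy => exact hlie x hx y hy
          | zero_left y hy => rw [zero_lie]; exact Submodule.zero_mem _
          | zero_right x hx => rw [lie_zero]; exact Submodule.zero_mem _
          | add_left x y z _ _ _ hx hy => rw [add_lie]; exact Submodule.add_mem _ hx hy
          | add_right x y z _ _ _ hx hy => rw [lie_add]; exact Submodule.add_mem _ hx hy
          | smul_left r x y _ _ h => rw [smul_lie]; exact Submodule.smul_mem _ _ h
          | smul_right r x y _ _ h => rw [lie_smul]; exact Submodule.smul_mem _ _ h }
    have : genAlg F G ≤ K := genAlg_le hF hG
    exact this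
  · rw [Submodule.span_le]
    exact fun x hx => hS x hx

/-- The disjunction of the six types of algebras. -/
def IsListed (L : LieSubalgebra ℝ TwoForm) : Prop :=
  IsR6 L ∨ IsR7 L ∨ IsR8 L ∨ IsR11 L ∨ IsR12 L ∨ IsR14 L

namespace NullTetrad

variable (T : NullTetrad)

theorem lie_A1_A2 : ⁅T.A1, T.A2⁆ = 0 := by
  rw [A1_eq, A2_eq, lie_el, ← el_zero]; congr 1 <;> ring

theorem lie_A1_A3 : ⁅T.A1, T.A3⁆ = T.A3 := by
  rw [A1_eq, A3_eq, lie_el]; congr 1 <;> ring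

theorem lie_A3_A4 : ⁅T.A3, T.A4⁆ = 0 := by
  rw [A3_eq, A4_eq, lie_el, ← el_zero]; congr 1 <;> ring

theorem el_nil (s t : ℝ) : T.el 0 0 s t = s • T.A3 + t • T.A4 := by
  simp only [el]; module

theorem A3_A4_mem {K : LieSubalgebra ℝ TwoForm} {s t s' t' : ℝ} (h : s * t' - t * s' ≠ 0)
    (h1 : T.el 0 0 s t ∈ K) (h2 : T.el 0 0 s' t' ∈ K) : T.A3 ∈ K ∧ T.A4 ∈ K := by
  rw [el_nil] at h1 h2
  exact mem_of_combinations_mem h h1 h2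

/-- Both generators in the nilradical. -/
theorem isR8_genAlg {s t s' t' : ℝ} (h : s * t' - t * s' ≠ 0) :
    IsR8 (genAlg (T.el 0 0 s t) (T.el 0 0 s' t')) := by
  obtain ⟨h3, h4⟩ := T.A3_A4_mem h (left_mem_genAlg _ _) (right_mem_genAlg _ _)
  have hmem : ∀ s t, T.el 0 0 s t ∈ Submodule.span ℝ {T.A3, T.A4} := fun s t =>
    Submodule.mem_span_pair.2 ⟨s, t, (T.el_nil s t).symm⟩
  refine ⟨T, genAlg_toSubmodule_eq_span (hmem _ _) (hmem _ _) ?_ ?_⟩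
  · rintro x (rfl | rfl) y (rfl | rfl) <;> simp [lie_A3_A4, ← lie_skew T.A4 T.A3]
  · rintro x (rfl | rfl)
    · exact h3
    · exact h4

/-- The parts of the generators along `A1`, `A2` span the plane of `A1`, `A2`. If the generators
commute, a null rotation removes their nilpotent parts. -/
theorem isListed_genAlg_of_independent_parts (s t s' t' : ℝ) :
    IsListed (genAlg (T.el 1 0 s t) (T.el 0 1 s' t')) := by
  set L := genAlg (T.el 1 0 s t) (T.el 0 1 s' t') with hL
  have hF : T.el 1 0 s t ∈ L := left_mem_genAlg _ _
  have hG : T.el 0 1 s' t' ∈ L := right_mem_genAlg _ _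
  by_cases h : s' + t = 0 ∧ t' - s = 0
  · refine Or.inr (Or.inl ⟨T.nullRot s t, ?_⟩)
    have e1 : T.el 1 0 s t = (T.nullRot s t).A1 := (T.nullRot_A1 s t).symm
    have e2 : T.el 0 1 s' t' = (T.nullRot s t).A2 := by
      rw [nullRot_A2]
      congr 1 <;> linarith [h.1, h.2]
    rw [hL, e1, e2]
    refine genAlg_toSubmodule_eq_span (Submodule.subset_span (by simp))
      (Submodule.subset_span (by simp)) ?_ ?_
    · rintro x (rfl | rfl) y (rfl | rfl) <;>
        simp [lie_A1_A2, ← lie_skew (T.nullRot s t).A2 (T.nullRot s t).A1]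
    · rintro x (rfl | rfl)
      · exact left_mem_genAlg _ _
      · exact right_mem_genAlg _ _
  · refine Or.inr (Or.inr (Or.inr (Or.inr (Or.inr ⟨T, ?_⟩))))
    have hE : T.el 0 0 (s' + t) (t' - s) ∈ L := by
      have := L.lie_mem hF hG
      rw [lie_el] at this
      convert this using 2 <;> ring
    have hE' : T.el 0 0 (-(t' - s)) (s' + t) ∈ L := by
      have := L.lie_mem hG hE
      rw [lie_el] at this
      convert this using 2 <;> ring
    have hne : (s' + t) * (s' + t) - (t' - s) * -(t' - s) ≠ 0 := by
      intro h0
      apply h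
      constructor <;> nlinarith [sq_nonneg (s' + t), sq_nonneg (t' - s)]
    obtain ⟨h3, h4⟩ := T.A3_A4_mem hne hE hE'
    have h34 : ∀ s t, T.el 0 0 s t ∈ L := fun s t => by
      rw [el_nil]
      exact add_mem (SMulMemClass.smul_mem _ h3) (SMulMemClass.smul_mem _ h4)
    have h1 : T.A1 ∈ L := by
      have : T.A1 = T.el 1 0 s t - T.el 0 0 s t := by simp only [el]; module
      rw [this]
      exact sub_mem hF (h34 s t)
    have h2 : T.A2 ∈ L := by
      have : T.A2 = T.el 0 1 s' t' - T.el 0 0 s' t' := by simp only [el]; module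
      rw [this]
      exact sub_mem hG (h34 s' t')
    have hmem : ∀ x y s t, T.el x y s t ∈ Submodule.span ℝ {T.A1, T.A2, T.A3, T.A4} :=
      fun x y s t => add_mem (add_mem (add_mem (Submodule.smul_mem _ _ (Submodule.subset_span
        (by simp))) (Submodule.smul_mem _ _ (Submodule.subset_span (by simp))))
        (Submodule.smul_mem _ _ (Submodule.subset_span (by simp))))
        (Submodule.smul_mem _ _ (Submodule.subset_span (by simp)))
    refine genAlg_toSubmodule_eq_span (hmem _ _ _ _) (hmem _ _ _ _) ?_ ?_
    · rintro x (rfl | rfl | rfl | rfl) y (rfl | rfl | rfl | rfl) <;>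
        simp only [A1_eq, A2_eq, A3_eq, A4_eq, lie_el] <;>
        simpa only [A1_eq, A2_eq, A3_eq, A4_eq] using hmem _ _ _ _
    · rintro x (rfl | rfl | rfl | rfl)
      · exact h1
      · exact h2
      · exact h3
      · exact h4

/-- One generator outside the nilradical and one in it. -/
theorem isListed_genAlg_of_right_nilpotent {x y : ℝ} (s t : ℝ) {s' t' : ℝ}
    (h : x ≠ 0 ∨ y ≠ 0) (h' : s' ≠ 0 ∨ t' ≠ 0) :
    IsListed (genAlg (T.el x y s t) (T.el 0 0 s' t')) := by
  set L := genAlg (T.el x y s t) (T.el 0 0 s' t') with hL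
  have hF : T.el x y s t ∈ L := left_mem_genAlg _ _
  have hG : T.el 0 0 s' t' ∈ L := right_mem_genAlg _ _
  have hpos : 0 < s' ^ 2 + t' ^ 2 := by
    rcases h' with h' | h' <;> positivity
  by_cases hy : y = 0
  · subst hy
    have hx : x ≠ 0 := by simpa using h
    -- After a null rotation the first generator is along `A1`, after a rotation the second one is
    -- along `A3`.
    set r := Real.sqrt (s' ^ 2 + t' ^ 2) with hr
    have hr2 : r ^ 2 = s' ^ 2 + t' ^ 2 := Real.sq_sqrt hpos.le
    have hr0 : r ≠ 0 := (Real.sqrt_pos.2 hpos).ne'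
    have hcd : (s' / r) ^ 2 + (t' / r) ^ 2 = 1 := by
      field_simp
      exact hr2.symm
    set T' := (T.nullRot (s / x) (t / x)).rot (s' / r) (t' / r) hcd with hT'
    have e1 : T.el x 0 s t = x • T'.A1 := by
      rw [hT', rot_A1, nullRot_A1, smul_el]
      congr 1 <;> field_simp
      ring
    have e3 : T.el 0 0 s' t' = r • T'.A3 := by
      rw [hT', rot_A3, nullRot_A3, nullRot_A4, el]
      match_scalars <;> field_simp
    refine Or.inl ⟨T', ?_⟩
    rw [hL, e1, e3]
    have m1 := left_mem_genAlg (x • T'.A1) (r • T'.A3)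
    have m3 := right_mem_genAlg (x • T'.A1) (r • T'.A3)
    refine genAlg_toSubmodule_eq_span (Submodule.smul_mem _ _ (Submodule.subset_span (by simp)))
      (Submodule.smul_mem _ _ (Submodule.subset_span (by simp))) ?_ ?_
    · have m : T'.A3 ∈ Submodule.span ℝ {T'.A1, T'.A3} := Submodule.subset_span (by simp)
      rintro x (rfl | rfl) y (rfl | rfl) <;>
        simp [lie_A1_A3, ← lie_skew T'.A3 T'.A1, m]
    · rintro z (rfl | rfl)
      · have := SMulMemClass.smul_mem x⁻¹ m1
        rwa [inv_smul_smul₀ hx] at this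
      · have := SMulMemClass.smul_mem r⁻¹ m3
        rwa [inv_smul_smul₀ hr0] at this
  · have hE : T.el 0 0 (x * s' - y * t') (x * t' + y * s') ∈ L := by
      have := L.lie_mem hF hG
      rw [lie_el] at this
      convert this using 2 <;> ring
    have hne : s' * (x * t' + y * s') - t' * (x * s' - y * t') ≠ 0 := by
      have : s' * (x * t' + y * s') - t' * (x * s' - y * t') = y * (s' ^ 2 + t' ^ 2) := by ring
      rw [this]
      exact mul_ne_zero hy hpos.ne'
    obtain ⟨h3, h4⟩ := T.A3_A4_mem hne hG hE
    have h34 : ∀ s t, T.el 0 0 s t ∈ L := fun s t => by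
      rw [el_nil]
      exact add_mem (SMulMemClass.smul_mem _ h3) (SMulMemClass.smul_mem _ h4)
    have h12 : T.el x y 0 0 ∈ L := by
      have : T.el x y 0 0 = T.el x y s t - T.el 0 0 s t := by simp only [el]; module
      rw [this]
      exact sub_mem hF (h34 s t)
    have key : ∀ (B : TwoForm) (c : ℝ), c ≠ 0 → c • B = T.el x y 0 0 →
        L.toSubmodule = Submodule.span ℝ {B, T.A3, T.A4} := by
      intro B c hc hB
      have hB' : B = T.el (c⁻¹ * x) (c⁻¹ * y) 0 0 := by
        rw [← inv_smul_smul₀ hc B, hB, smul_el, mul_zero]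
      have mB : B ∈ Submodule.span ℝ {B, T.A3, T.A4} := Submodule.subset_span (by simp)
      have m34 : ∀ s t, T.el 0 0 s t ∈ Submodule.span ℝ {B, T.A3, T.A4} := fun s t => by
        rw [el_nil]
        exact add_mem (Submodule.smul_mem _ _ (Submodule.subset_span (by simp)))
          (Submodule.smul_mem _ _ (Submodule.subset_span (by simp)))
      have mlie : ∀ x y s t x' y' s' t', ⁅T.el x y s t, T.el x' y' s' t'⁆ ∈
          Submodule.span ℝ {B, T.A3, T.A4} := fun x y s t x' y' s' t' => by
        rw [lie_el]
        exact m34 _ _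
      refine genAlg_toSubmodule_eq_span ?_ (m34 _ _) ?_ ?_
      · have : T.el x y s t = c • B + T.el 0 0 s t := by rw [hB]; simp only [el]; module
        rw [this]
        exact add_mem (Submodule.smul_mem _ _ mB) (m34 _ _)
      · have hel : ∀ z ∈ ({B, T.A3, T.A4} : Set TwoForm), ∃ x y s t, z = T.el x y s t := by
          rintro z (rfl | rfl | rfl)
          · exact ⟨_, _, _, _, hB'⟩
          · exact ⟨_, _, _, _, T.A3_eq⟩
          · exact ⟨_, _, _, _, T.A4_eq⟩
        intro z hz w hw
        obtain ⟨x, y, s, t, hz⟩ := hel z hz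
        obtain ⟨x', y', s', t', hw⟩ := hel w hw
        rw [hz, hw]
        exact mlie _ _ _ _ _ _ _ _
      · rintro z (rfl | rfl | rfl)
        · have := SMulMemClass.smul_mem c⁻¹ h12
          rwa [← hB, inv_smul_smul₀ hc] at this
        · exact h3
        · exact h4
    by_cases hx : x = 0
    · refine Or.inr (Or.inr (Or.inr (Or.inl ⟨T, key T.A2 y hy ?_⟩)))
      rw [hx]; simp only [el]; module
    · refine Or.inr (Or.inr (Or.inr (Or.inr (Or.inl
        ⟨T, y / x, div_ne_zero hy hx, key _ x hx ?_⟩))))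
      simp only [el]
      match_scalars <;> field_simp

/-- Two linearly independent elements of the Borel algebra generate an algebra of one of the six
types. The cases are distinguished by the real dimension of the span of the complex coordinates
of the generators modulo the nilradical. -/
theorem isListed_genAlg {F G : TwoForm} (hF : F ∈ T.borel) (hG : G ∈ T.borel)
    (hFG : LinearIndependent ℝ ![F, G]) : IsListed (genAlg F G) := by
  -- A nontrivial relation between two elements of the nilradical.
  have hnil : ∀ {F G : TwoForm} {s t s' t' : ℝ}, F = T.el 0 0 s t → G = T.el 0 0 s' t' →
      LinearIndependent ℝ ![F, G] → s * t' - t * s' ≠ 0 := by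
    rintro F G s t s' t' rfl rfl h h0
    rw [LinearIndependent.pair_iff] at h
    have h1 := h t' (-t) (by
      rw [smul_el, smul_el, el_add, ← T.el_zero]
      congr 1 <;> linarith)
    have h2 := h s' (-s) (by
      rw [smul_el, smul_el, el_add, ← T.el_zero]
      congr 1 <;> linarith)
    have h3 := h 1 0 (by
      rw [smul_el, smul_el, el_add, ← T.el_zero]
      congr 1 <;> linarith [h1.2, h2.2])
    exact one_ne_zero h3.1
  -- One generator is outside the nilradical, and its multiple is a part of the other one.
  have hone : ∀ {F G : TwoForm} {x y s t x' y' s' t' : ℝ}, F = T.el x y s t →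
      G = T.el x' y' s' t' → LinearIndependent ℝ ![F, G] → x * y' - y * x' = 0 →
      (x ≠ 0 ∨ y ≠ 0) → IsListed (genAlg F G) := by
    intro F G x y s t x' y' s' t' hF hG h hdet hxy
    have hpos : 0 < x ^ 2 + y ^ 2 := by rcases hxy with h | h <;> positivity
    set c := (x * x' + y * y') / (x ^ 2 + y ^ 2) with hc
    have hx : x' = c * x := by
      rw [hc]; field_simp; linear_combination (-y) * hdet
    have hy : y' = c * y := by
      rw [hc]; field_simp; linear_combination x * hdet
    have hG' : -c • F + (1 : ℝ) • G = T.el 0 0 (s' - c * s) (t' - c * t) := by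
      rw [hF, hG, smul_el, smul_el, el_add]
      congr 1
      · rw [hx]; ring
      · rw [hy]; ring
      · ring
      · ring
    rw [← genAlg_combination F G (a := 1) (b := 0) (c := -c) (d := 1) (by norm_num), hG',
      zero_smul, add_zero, one_smul, hF]
    apply T.isListed_genAlg_of_right_nilpotent s t hxy
    by_contra! h0
    rw [h0.1, h0.2, el_zero] at hG'
    rw [LinearIndependent.pair_iff] at h
    exact one_ne_zero (h _ _ hG').2
  obtain ⟨x, y, s, t, hF⟩ := hF
  obtain ⟨x', y', s', t', hG⟩ := hG
  by_cases hdet : x * y' - y * x' = 0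
  · by_cases hxy : x ≠ 0 ∨ y ≠ 0
    · exact hone hF hG hFG hdet hxy
    · by_cases hxy' : x' ≠ 0 ∨ y' ≠ 0
      · rw [genAlg_comm]
        refine hone hG hF ?_ (by linear_combination -hdet) hxy'
        rw [LinearIndependent.pair_iff] at hFG ⊢
        intro a b hab
        exact (hFG b a (by rw [add_comm]; exact hab)).symm
      · push Not at hxy hxy'
        rw [hxy.1, hxy.2] at hF
        rw [hxy'.1, hxy'.2] at hG
        have := T.isR8_genAlg (hnil hF hG hFG)
        rw [← hF, ← hG] at this
        exact Or.inr (Or.inr (Or.inl this))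
  · -- The generators are normalized so that their parts modulo the nilradical are `1` and `i`.
    obtain ⟨i, hi⟩ : ∃ i : ℝ, i * (x * y' - y * x') = 1 := ⟨_, inv_mul_cancel₀ hdet⟩
    have hi0 : i ≠ 0 := left_ne_zero_of_mul_eq_one hi
    rw [← genAlg_combination F G (a := i * y') (b := -(i * y)) (c := -(i * x')) (d := i * x)
      (by
        have : i * y' * (i * x) - -(i * y) * -(i * x') = i := by linear_combination i * hi
        rwa [this])]
    have e1 : (i * y') • F + (-(i * y)) • G = T.el 1 0 (i * y' * s - i * y * s')
        (i * y' * t - i * y * t') := by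
      rw [hF, hG, smul_el, smul_el, el_add]
      congr 1
      · linear_combination hi
      · ring
      · ring
      · ring
    have e2 : (-(i * x')) • F + (i * x) • G = T.el 0 1 (-(i * x') * s + i * x * s')
        (-(i * x') * t + i * x * t') := by
      rw [hF, hG, smul_el, smul_el, el_add]
      congr 1
      · ring
      · linear_combination hi
    rw [e1, e2]
    exact T.isListed_genAlg_of_independent_parts _ _ _ _

theorem A1_mem_borel : T.A1 ∈ T.borel := T.A1_eq ▸ T.el_mem_borel ..
theorem A2_mem_borel : T.A2 ∈ T.borel := T.A2_eq ▸ T.el_mem_borel ..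
theorem A3_mem_borel : T.A3 ∈ T.borel := T.A3_eq ▸ T.el_mem_borel ..
theorem A4_mem_borel : T.A4 ∈ T.borel := T.A4_eq ▸ T.el_mem_borel ..

end NullTetrad

theorem IsListed.exists_le_borel {L : LieSubalgebra ℝ TwoForm} (h : IsListed L) :
    ∃ T : NullTetrad, L ≤ T.borel := by
  have key : ∀ (T : NullTetrad) (S : Set TwoForm), L.toSubmodule = Submodule.span ℝ S →
      (∀ x ∈ S, x ∈ T.borel) → L ≤ T.borel := by
    intro T S hL hS
    have h1 : L.toSubmodule ≤ T.borel.toSubmodule := by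
      rw [hL, Submodule.span_le]
      exact hS
    exact h1
  rcases h with ⟨T, h⟩ | ⟨T, h⟩ | ⟨T, h⟩ | ⟨T, h⟩ | ⟨T, τ, -, h⟩ | ⟨T, h⟩ <;>
    refine ⟨T, key T _ h ?_⟩
  · rintro x (rfl | rfl)
    exacts [T.A1_mem_borel, T.A3_mem_borel]
  · rintro x (rfl | rfl)
    exacts [T.A1_mem_borel, T.A2_mem_borel]
  · rintro x (rfl | rfl)
    exacts [T.A3_mem_borel, T.A4_mem_borel]
  · rintro x (rfl | rfl | rfl)
    exacts [T.A2_mem_borel, T.A3_mem_borel, T.A4_mem_borel]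
  · rintro x (rfl | rfl | rfl)
    exacts [add_mem T.A1_mem_borel (SMulMemClass.smul_mem τ T.A2_mem_borel), T.A3_mem_borel,
      T.A4_mem_borel]
  · rintro x (rfl | rfl | rfl | rfl)
    exacts [T.A1_mem_borel, T.A2_mem_borel, T.A3_mem_borel, T.A4_mem_borel]

/-! ### Killing forms -/

/-- In a metabelian Lie algebra `ad x ∘ ad w = 0` for each commutator `x`, so that all the
commutators are in the kernel of the Killing form. -/
theorem not_nondegenerate_of_metabelian {L : Type*} [LieRing L] [LieAlgebra ℝ L] [Nontrivial L]
    (h : ∀ a b c d : L, ⁅⁅a, b⁆, ⁅c, d⁆⁆ = 0) : ¬ (killingForm ℝ L).Nondegenerate := by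
  intro hn
  have hcomm : ∀ a b : L, ⁅a, b⁆ = 0 := fun a b => by
    refine hn.1 _ fun w => ?_
    rw [killingForm_apply_apply]
    have : LieAlgebra.ad ℝ L ⁅a, b⁆ ∘ₗ LieAlgebra.ad ℝ L w = 0 := by
      ext v
      exact h a b w v
    rw [this, map_zero]
  obtain ⟨x, hx⟩ := exists_ne (0 : L)
  apply hx
  refine hn.1 _ fun w => ?_
  rw [killingForm_apply_apply]
  have : LieAlgebra.ad ℝ L x ∘ₗ LieAlgebra.ad ℝ L w = 0 := by
    ext v
    exact hcomm x ⁅w, v⁆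
  rw [this, map_zero]

theorem not_nondegenerate_of_le_borel {F G : TwoForm} (hF : F ≠ 0) {T : NullTetrad}
    (h : genAlg F G ≤ T.borel) : ¬ (killingForm ℝ (genAlg F G)).Nondegenerate := by
  have : Nontrivial (genAlg F G) :=
    ⟨⟨F, left_mem_genAlg F G⟩, 0, fun h0 => hF (congrArg Subtype.val h0)⟩
  apply not_nondegenerate_of_metabelian
  intro a b c d
  exact Subtype.ext (T.borel_metabelian (h a.2) (h b.2) (h c.2) (h d.2))

theorem killingForm_nondegenerate_of_separatingLeft {L : Type*} [LieRing L] [LieAlgebra ℝ L]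
    (h : ∀ x : L, (∀ y, killingForm ℝ L x y = 0) → x = 0) :
    (killingForm ℝ L).Nondegenerate := by
  refine ⟨h, fun y hy => h y fun x => ?_⟩
  rw [LieModule.traceForm_comm]
  exact hy x

/-- The Killing form of a three-dimensional algebra generated by two elements with real Gram matrix
`(a, b; b, c)`. -/
theorem killingForm_nondegenerate_of_basis {L : Type*} [LieRing L] [LieAlgebra ℝ L]
    (B : Module.Basis (Fin 3) ℝ L) {a b c : ℝ} (h01 : ⁅B 0, B 1⁆ = B 2)
    (h20 : ⁅B 2, B 0⁆ = b • B 0 - a • B 1) (h21 : ⁅B 2, B 1⁆ = c • B 0 - b • B 1)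
    (hdet : a * c - b ^ 2 ≠ 0) : (killingForm ℝ L).Nondegenerate := by
  have h10 : ⁅B 1, B 0⁆ = -B 2 := by rw [← lie_skew, h01]
  have h02 : ⁅B 0, B 2⁆ = a • B 1 - b • B 0 := by rw [← lie_skew, h20]; module
  have h12 : ⁅B 1, B 2⁆ = b • B 1 - c • B 0 := by rw [← lie_skew, h21]; module
  have m0 : LinearMap.toMatrix B B (LieAlgebra.ad ℝ L (B 0)) = !![0, 0, -b; 0, 0, a; 0, 1, 0] := by
    ext i j
    fin_cases j <;> fin_cases i <;> simp [LinearMap.toMatrix_apply, h01, h02]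
  have m1 : LinearMap.toMatrix B B (LieAlgebra.ad ℝ L (B 1)) =
      !![0, 0, -c; 0, 0, b; -1, 0, 0] := by
    ext i j
    fin_cases j <;> fin_cases i <;> simp [LinearMap.toMatrix_apply, h10, h12]
  have m2 : LinearMap.toMatrix B B (LieAlgebra.ad ℝ L (B 2)) =
      !![b, c, 0; -a, -b, 0; 0, 0, 0] := by
    ext i j
    fin_cases j <;> fin_cases i <;> simp [LinearMap.toMatrix_apply, h20, h21]
  have hκ : ∀ x y, killingForm ℝ L x y = (LinearMap.toMatrix B B (LieAlgebra.ad ℝ L x) *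
      LinearMap.toMatrix B B (LieAlgebra.ad ℝ L y)).trace := fun x y => by
    rw [killingForm_apply_apply, LinearMap.trace_eq_matrix_trace ℝ B, LinearMap.toMatrix_comp B B B]
  apply killingForm_nondegenerate_of_separatingLeft
  intro x hx
  have hexp := B.sum_repr x
  rw [Fin.sum_univ_three] at hexp
  generalize B.repr x 0 = x0 at hexp
  generalize B.repr x 1 = x1 at hexp
  generalize B.repr x 2 = x2 at hexp
  have e0 := hx (B 0)
  have e1 := hx (B 1)
  have e2 := hx (B 2)
  rw [← hexp] at e0 e1 e2
  simp [hκ, m0, m1, m2, Matrix.trace, Fin.sum_univ_three] at e0 e1 e2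
  have z0 : x0 = 0 := by
    apply (mul_eq_zero.1 (_ : (a * c - b ^ 2) * x0 = 0)).resolve_left hdet
    linear_combination (c / 2) * e0 - (b / 2) * e1
  have z1 : x1 = 0 := by
    apply (mul_eq_zero.1 (_ : (a * c - b ^ 2) * x1 = 0)).resolve_left hdet
    linear_combination (a / 2) * e1 - (b / 2) * e0
  have z2 : x2 = 0 := e2.resolve_right fun h0 => hdet (by linear_combination (-1 / 2) * h0)
  rw [← hexp, z0, z1, z2]
  module

/-- The Killing form of the Lorentz algebra is `4 re (z · w)`. -/
theorem killingForm_twoForm (F G : TwoForm) :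
    killingForm ℝ TwoForm F G = 4 * (cvec F ⬝ᵥ cvec G).re := by
  let B : Module.Basis (Σ _ : Fin 3, Fin 2) ℝ TwoForm :=
    (Pi.basis fun _ : Fin 3 => Complex.basisOneI).map cvec.symm
  rw [killingForm_apply_apply, LinearMap.trace_eq_matrix_trace ℝ B, Matrix.trace,
    Fintype.sum_sigma]
  simp only [Matrix.diag_apply, LinearMap.toMatrix_apply, LinearMap.comp_apply, LieAlgebra.ad_apply,
    B, Module.Basis.map_repr, Module.Basis.map_apply, LinearEquiv.trans_apply,
    LinearEquiv.symm_symm, cvec_lie, Pi.basis_repr, Pi.basis_apply, LinearEquiv.apply_symm_apply]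
  simp [Fin.sum_univ_three, cross_apply, dotProduct]
  ring

theorem killingForm_twoForm_nondegenerate : (killingForm ℝ TwoForm).Nondegenerate := by
  apply killingForm_nondegenerate_of_separatingLeft
  intro F hF
  have h := hF (cvec.symm fun i => starRingEnd ℂ (cvec F i))
  rw [killingForm_twoForm, LinearEquiv.apply_symm_apply] at h
  simp [dotProduct, Fin.sum_univ_three] at h
  apply cvec.injective
  rw [map_zero]
  have key : ∀ i, cvec F i = 0 := fun i => by
    apply Complex.ext
    all_goals
      fin_cases i <;> simp <;> nlinarith
  exact funext key

/-! ### Two-forms without common null direction -/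

section Gram

variable {F G : TwoForm}

theorem cvec_star_smul_add (c : ℂ) (F : TwoForm) :
    cvec (c.re • F + c.im • star F) = c • cvec F := by
  rw [map_add, map_smul, map_smul, cvec_star]
  ext i
  simp only [Pi.add_apply, Pi.smul_apply, smul_eq_mul, Complex.real_smul]
  conv_rhs => rw [← Complex.re_add_im c]
  ring

theorem star_lie (F G : TwoForm) : ⁅star F, G⁆ = star ⁅F, G⁆ := by
  apply cvec.injective
  rw [cvec_lie, cvec_star, cvec_star, cvec_lie]
  simp

theorem cvec_lie_lie_left (F G : TwoForm) : cvec ⁅⁅F, G⁆, F⁆ =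
    (cvec F ⬝ᵥ cvec G) • cvec F - (cvec F ⬝ᵥ cvec F) • cvec G := by
  rw [cvec_lie, cvec_lie]
  ext i
  fin_cases i <;> simp [cross_apply, dotProduct, Fin.sum_univ_three] <;> ring_nf <;>
    simp only [Complex.I_sq] <;> ring

theorem cvec_lie_lie_right (F G : TwoForm) : cvec ⁅⁅F, G⁆, G⁆ =
    (cvec G ⬝ᵥ cvec G) • cvec F - (cvec F ⬝ᵥ cvec G) • cvec G := by
  rw [cvec_lie, cvec_lie]
  ext i
  fin_cases i <;> simp [cross_apply, dotProduct, Fin.sum_univ_three] <;> ring_nf <;>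
    simp only [Complex.I_sq] <;> ring

/-- Two-forms with nonzero Gram determinant and their bracket form a complex basis. -/
theorem exists_cvec_eq (h : gram F G ≠ 0) (u : Fin 3 → ℂ) :
    ∃ x y t : ℂ, u = x • cvec F + y • cvec G + t • cvec ⁅F, G⁆ := by
  obtain ⟨i, hi⟩ : ∃ i : ℂ, i * gram F G = 1 := ⟨_, inv_mul_cancel₀ h⟩
  have hI : Complex.I ^ 2 = -1 := Complex.I_sq
  refine ⟨i * ((u ⬝ᵥ cvec F) * (cvec G ⬝ᵥ cvec G) - (u ⬝ᵥ cvec G) * (cvec F ⬝ᵥ cvec G)),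
    i * ((u ⬝ᵥ cvec G) * (cvec F ⬝ᵥ cvec F) - (u ⬝ᵥ cvec F) * (cvec F ⬝ᵥ cvec G)),
    i * -(u ⬝ᵥ cvec ⁅F, G⁆), ?_⟩
  rw [cvec_lie]
  simp only [gram, dotProduct, Fin.sum_univ_three] at hi ⊢
  ext j
  fin_cases j <;> simp [cross_apply] <;> ring_nf <;> simp only [hI]
  · linear_combination (-u 0) * hi
  · linear_combination (-u 1) * hi
  · linear_combination (-u 2) * hi

theorem linearIndependent_of_gram_ne_zero (h : gram F G ≠ 0) :
    LinearIndependent ℝ ![F, G, ⁅F, G⁆] := by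
  rw [Fintype.linearIndependent_iff]
  intro r hr
  simp only [Fin.sum_univ_three] at hr
  change r 0 • F + r 1 • G + r 2 • ⁅F, G⁆ = 0 at hr
  have hE1 : cvec F ⬝ᵥ cvec ⁅F, G⁆ = 0 := by
    rw [cvec_lie, dotProduct_smul, dot_self_cross, smul_zero]
  have hE2 : cvec G ⬝ᵥ cvec ⁅F, G⁆ = 0 := by
    rw [cvec_lie, dotProduct_smul, dot_cross_self, smul_zero]
  have hE3 : cvec ⁅F, G⁆ ⬝ᵥ cvec ⁅F, G⁆ = -gram F G := by
    rw [cvec_lie, smul_dotProduct, dotProduct_smul, cross_dot_cross,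
      dotProduct_comm (cvec G) (cvec F), gram, smul_smul, Complex.I_mul_I, neg_one_smul]
    ring
  have hz := congrArg cvec hr
  rw [map_add, map_add, map_smul, map_smul, map_smul, map_zero] at hz
  have d0 := congrArg (cvec F ⬝ᵥ ·) hz
  have d1 := congrArg (cvec G ⬝ᵥ ·) hz
  have d2 := congrArg (cvec ⁅F, G⁆ ⬝ᵥ ·) hz
  simp only [dotProduct_add, dotProduct_smul, dotProduct_zero, hE1, hE2, hE3, smul_zero,
    dotProduct_comm (cvec ⁅F, G⁆) (cvec F), dotProduct_comm (cvec ⁅F, G⁆) (cvec G),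
    dotProduct_comm (cvec G) (cvec F), Complex.real_smul] at d0 d1 d2
  have key : ∀ r : ℝ, gram F G * r = 0 → r = 0 := fun r hr =>
    Complex.ofReal_eq_zero.1 ((mul_eq_zero.1 hr).resolve_left h)
  have k0 : r 0 = 0 := by
    apply key
    simp only [gram]
    linear_combination (cvec G ⬝ᵥ cvec G) * d0 - (cvec F ⬝ᵥ cvec G) * d1
  have k1 : r 1 = 0 := by
    apply key
    simp only [gram]
    linear_combination (cvec F ⬝ᵥ cvec F) * d1 - (cvec F ⬝ᵥ cvec G) * d0
  have k2 : r 2 = 0 := by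
    apply key
    linear_combination -d2
  intro i
  fin_cases i
  exacts [k0, k1, k2]

/-- If the Gram matrix is real, the generators and their bracket are a real basis of the generated
algebra, a real form of the complex algebra. -/
theorem nondegenerate_of_gram_real (h : gram F G ≠ 0) {a b c : ℝ}
    (ha : cvec F ⬝ᵥ cvec F = a) (hb : cvec F ⬝ᵥ cvec G = b) (hc : cvec G ⬝ᵥ cvec G = c) :
    (killingForm ℝ (genAlg F G)).Nondegenerate := by
  have e20 : ⁅⁅F, G⁆, F⁆ = b • F - a • G := by
    apply cvec.injective
    rw [cvec_lie_lie_left, hb, ha, map_sub, map_smul, map_smul]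
    ext i; simp
  have e21 : ⁅⁅F, G⁆, G⁆ = c • F - b • G := by
    apply cvec.injective
    rw [cvec_lie_lie_right, hb, hc, map_sub, map_smul, map_smul]
    ext i; simp
  have mF := left_mem_genAlg F G
  have mG := right_mem_genAlg F G
  have hspan : (genAlg F G).toSubmodule = Submodule.span ℝ {F, G, ⁅F, G⁆} := by
    have sF : F ∈ Submodule.span ℝ {F, G, ⁅F, G⁆} := Submodule.subset_span (by simp)
    have sG : G ∈ Submodule.span ℝ {F, G, ⁅F, G⁆} := Submodule.subset_span (by simp)
    have sE : ⁅F, G⁆ ∈ Submodule.span ℝ {F, G, ⁅F, G⁆} := Submodule.subset_span (by simp)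
    have s20 : ⁅⁅F, G⁆, F⁆ ∈ Submodule.span ℝ {F, G, ⁅F, G⁆} := by
      rw [e20]; exact sub_mem (Submodule.smul_mem _ _ sF) (Submodule.smul_mem _ _ sG)
    have s21 : ⁅⁅F, G⁆, G⁆ ∈ Submodule.span ℝ {F, G, ⁅F, G⁆} := by
      rw [e21]; exact sub_mem (Submodule.smul_mem _ _ sF) (Submodule.smul_mem _ _ sG)
    have s02 : ⁅F, ⁅F, G⁆⁆ ∈ Submodule.span ℝ {F, G, ⁅F, G⁆} := by
      rw [← lie_skew F ⁅F, G⁆]; exact neg_mem s20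
    have s12 : ⁅G, ⁅F, G⁆⁆ ∈ Submodule.span ℝ {F, G, ⁅F, G⁆} := by
      rw [← lie_skew G ⁅F, G⁆]; exact neg_mem s21
    have s10 : ⁅G, F⁆ ∈ Submodule.span ℝ {F, G, ⁅F, G⁆} := by
      rw [← lie_skew G F]; exact neg_mem sE
    refine genAlg_toSubmodule_eq_span sF sG ?_ ?_
    · rintro x (rfl | rfl | rfl) y (rfl | rfl | rfl)
      · rw [lie_self]; exact zero_mem _
      · exact sE
      · exact s02
      · exact s10
      · rw [lie_self]; exact zero_mem _
      · exact s12
      · exact s20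
      · exact s21
      · rw [lie_self]; exact zero_mem _
    · rintro x (rfl | rfl | rfl)
      exacts [mF, mG, (genAlg F G).lie_mem mF mG]
  let v : Fin 3 → genAlg F G := ![⟨F, mF⟩, ⟨G, mG⟩, ⟨⁅F, G⁆, (genAlg F G).lie_mem mF mG⟩]
  have hli : LinearIndependent ℝ v := by
    apply LinearIndependent.of_comp (genAlg F G).toSubmodule.subtype
    have hv : (genAlg F G).toSubmodule.subtype ∘ v = ![F, G, ⁅F, G⁆] := by
      ext i : 1
      fin_cases i <;> rfl
    rw [hv]
    exact linearIndependent_of_gram_ne_zero h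
  have htop : ⊤ ≤ Submodule.span ℝ (Set.range v) := by
    rintro ⟨x, hx⟩ -
    have hx' : x ∈ Submodule.span ℝ {F, G, ⁅F, G⁆} := by rw [← hspan]; exact hx
    obtain ⟨r, s, t, rfl⟩ := Submodule.mem_span_triple.1 hx'
    have : (⟨r • F + s • G + t • ⁅F, G⁆, hx⟩ : genAlg F G) = r • v 0 + s • v 1 + t • v 2 := rfl
    rw [this]
    exact add_mem (add_mem (Submodule.smul_mem _ _ (Submodule.subset_span ⟨0, rfl⟩))
      (Submodule.smul_mem _ _ (Submodule.subset_span ⟨1, rfl⟩)))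
      (Submodule.smul_mem _ _ (Submodule.subset_span ⟨2, rfl⟩))
  refine killingForm_nondegenerate_of_basis (Module.Basis.mk hli htop) (a := a) (b := b) (c := c)
    ?_ ?_ ?_ ?_
  · simp only [Module.Basis.mk_apply]; rfl
  · simp only [Module.Basis.mk_apply]; exact Subtype.ext e20
  · simp only [Module.Basis.mk_apply]; exact Subtype.ext e21
  · intro h0
    apply h
    rw [gram, ha, hb, hc]
    exact_mod_cast h0

theorem eq_top_of_star_mem (h : gram F G ≠ 0) {L : LieSubalgebra ℝ TwoForm} (hF : F ∈ L)
    (hG : G ∈ L) (hF' : star F ∈ L) (hG' : star G ∈ L) : L = ⊤ := by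
  rw [eq_top_iff]
  intro H _
  obtain ⟨x, y, t, hH⟩ := exists_cvec_eq h (cvec H)
  rw [← cvec_star_smul_add, ← cvec_star_smul_add, ← cvec_star_smul_add, ← map_add, ← map_add] at hH
  rw [cvec.injective hH, ← star_lie]
  have hc : ∀ {A B : TwoForm} (c : ℂ), A ∈ L → B ∈ L → c.re • A + c.im • B ∈ L :=
    fun c hA hB => add_mem (SMulMemClass.smul_mem _ hA) (SMulMemClass.smul_mem _ hB)
  exact add_mem (add_mem (hc x hF hF') (hc y hG hG')) (hc t (L.lie_mem hF hG) (L.lie_mem hF' hG))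

/-- If the Gram matrix is not real, the real algebra generated by `F` and `G` is stable under the
dual, hence it is the whole Lorentz algebra. -/
theorem genAlg_eq_top (h : gram F G ≠ 0)
    (him : (cvec F ⬝ᵥ cvec F).im ≠ 0 ∨ (cvec F ⬝ᵥ cvec G).im ≠ 0 ∨ (cvec G ⬝ᵥ cvec G).im ≠ 0) :
    genAlg F G = ⊤ := by
  set L := genAlg F G with hL
  have mF : F ∈ L := left_mem_genAlg F G
  have mG : G ∈ L := right_mem_genAlg F G
  have mE : ⁅F, G⁆ ∈ L := L.lie_mem mF mG
  have e20 : ∀ E : TwoForm, cvec E = (cvec F ⬝ᵥ cvec G) • cvec F - (cvec F ⬝ᵥ cvec F) • cvec G →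
      E = (cvec F ⬝ᵥ cvec G).re • F + (cvec F ⬝ᵥ cvec G).im • star F -
        ((cvec F ⬝ᵥ cvec F).re • G + (cvec F ⬝ᵥ cvec F).im • star G) := fun E hE => by
    apply cvec.injective
    rw [hE, map_sub, cvec_star_smul_add, cvec_star_smul_add]
  have e21 : ∀ E : TwoForm, cvec E = (cvec G ⬝ᵥ cvec G) • cvec F - (cvec F ⬝ᵥ cvec G) • cvec G →
      E = (cvec G ⬝ᵥ cvec G).re • F + (cvec G ⬝ᵥ cvec G).im • star F -
        ((cvec F ⬝ᵥ cvec G).re • G + (cvec F ⬝ᵥ cvec G).im • star G) := fun E hE => by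
    apply cvec.injective
    rw [hE, map_sub, cvec_star_smul_add, cvec_star_smul_add]
  have m20 := L.lie_mem mE mF
  have m21 := L.lie_mem mE mG
  have h20 := e20 _ (cvec_lie_lie_left F G)
  have h21 := e21 _ (cvec_lie_lie_right F G)
  have star_add : ∀ A B : TwoForm, star (A + B) = star A + star B := fun A B => by
    apply cvec.injective
    simp only [cvec_star, map_add, smul_add]
  have star_smul : ∀ (r : ℝ) (A : TwoForm), star (r • A) = r • star A := fun r A => by
    apply cvec.injective
    simp only [cvec_star, map_smul]
    rw [smul_comm]
  have star_star : ∀ A : TwoForm, star (star A) = -A := fun A => by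
    apply cvec.injective
    rw [cvec_star, cvec_star, smul_smul, Complex.I_mul_I, map_neg, neg_one_smul]
  have star_neg : ∀ A : TwoForm, star (-A) = -star A := fun A => by
    apply cvec.injective
    simp only [cvec_star, map_neg, smul_neg]
  rw [h20] at m20
  rw [h21] at m21
  generalize ha : cvec F ⬝ᵥ cvec F = a at *
  generalize hb : cvec F ⬝ᵥ cvec G = b at *
  generalize hc : cvec G ⬝ᵥ cvec G = c at *
  have i1 : b.im • star F + (-a.im) • star G ∈ L := by
    have := add_mem (sub_mem m20 (SMulMemClass.smul_mem b.re mF)) (SMulMemClass.smul_mem a.re mG)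
    convert this using 1
    module
  have i2 : c.im • star F + (-b.im) • star G ∈ L := by
    have := add_mem (sub_mem m21 (SMulMemClass.smul_mem c.re mF)) (SMulMemClass.smul_mem b.re mG)
    convert this using 1
    module
  -- The dual of a nonzero combination of `F` and `G` is in `L`, hence so is the dual of `[F, G]`.
  have mE' : star ⁅F, G⁆ ∈ L := by
    have key : ∀ u v : ℝ, u • star F + v • star G ∈ L → u ≠ 0 ∨ v ≠ 0 → star ⁅F, G⁆ ∈ L := by
      intro u v huv hne
      rcases hne with hu | hv
      · have := SMulMemClass.smul_mem u⁻¹ (L.lie_mem huv mG)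
        rwa [add_lie, smul_lie, smul_lie, star_lie, star_lie, lie_self,
          show star (0 : TwoForm) = 0 by simpa using star_smul 0 0, smul_zero, add_zero,
          inv_smul_smul₀ hu] at this
      · have := SMulMemClass.smul_mem (-v)⁻¹ (L.lie_mem huv mF)
        rwa [add_lie, smul_lie, smul_lie, star_lie, star_lie, lie_self,
          show star (0 : TwoForm) = 0 by simpa using star_smul 0 0, smul_zero, zero_add,
          ← lie_skew, star_neg, smul_neg, ← neg_smul, inv_smul_smul₀ (neg_ne_zero.2 hv)] at this
    rcases him with h1 | h1 | h1
    · exact key _ _ i1 (Or.inr (neg_ne_zero.2 h1))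
    · exact key _ _ i1 (Or.inl h1)
    · exact key _ _ i2 (Or.inl h1)
  have r1 : b.re • star F + (-a.re) • star G ∈ L := by
    have h1 := L.lie_mem mE' mF
    rw [star_lie, h20, sub_eq_add_neg, star_add, star_add, star_neg, star_add, star_smul, star_smul,
      star_smul, star_smul, star_star, star_star] at h1
    have := sub_mem (add_mem h1 (SMulMemClass.smul_mem b.im mF)) (SMulMemClass.smul_mem a.im mG)
    convert this using 1
    module
  have r2 : c.re • star F + (-b.re) • star G ∈ L := by
    have h1 := L.lie_mem mE' mG
    rw [star_lie, h21, sub_eq_add_neg, star_add, star_add, star_neg, star_add, star_smul, star_smul,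
      star_smul, star_smul, star_star, star_star] at h1
    have := sub_mem (add_mem h1 (SMulMemClass.smul_mem c.im mF)) (SMulMemClass.smul_mem b.im mG)
    convert this using 1
    module
  -- If the four combinations were all parallel, the Gram determinant would vanish.
  have hstar : star F ∈ L ∧ star G ∈ L := by
    by_contra hno
    have q : ∀ {x y x' y' : ℝ}, x • star F + y • star G ∈ L → x' • star F + y' • star G ∈ L →
        x * y' - y * x' = 0 := fun h1 h2 => by
      by_contra h0
      exact hno (mem_of_combinations_mem h0 h1 h2)
    have q1 := q r1 r2
    have q2 := q i1 i2
    have q3 := q r1 i2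
    have q4 := q i1 r2
    apply h
    rw [gram, ha, hb, hc]
    apply Complex.ext
    · simp [pow_two]
      linarith
    · simp [pow_two]
      linarith
  exact eq_top_of_star_mem h mF mG hstar.1 hstar.2

/-- Without a common null direction the Killing form is nondegenerate. -/
theorem nondegenerate_of_gram_ne_zero (h : gram F G ≠ 0) :
    (killingForm ℝ (genAlg F G)).Nondegenerate := by
  by_cases him : (cvec F ⬝ᵥ cvec F).im ≠ 0 ∨ (cvec F ⬝ᵥ cvec G).im ≠ 0 ∨
      (cvec G ⬝ᵥ cvec G).im ≠ 0
  · rw [genAlg_eq_top h him]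
    apply killingForm_nondegenerate_of_separatingLeft
    intro x hx
    have h0 := killingForm_twoForm_nondegenerate.1 (LieSubalgebra.topEquiv x) fun y => by
      have := hx (LieSubalgebra.topEquiv.symm y)
      rw [← LieAlgebra.killingForm_of_equiv_apply LieSubalgebra.topEquiv] at this
      simpa using this
    simpa using h0
  · push Not at him
    have hreal : ∀ z : ℂ, z.im = 0 → z = (z.re : ℂ) := fun z hz => by
      apply Complex.ext <;> simp [hz]
    exact nondegenerate_of_gram_real h (hreal _ him.1) (hreal _ him.2.1) (hreal _ him.2.2)

theorem not_nondegenerate_iff (hF : F ≠ 0) :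
    ¬ (killingForm ℝ (genAlg F G)).Nondegenerate ↔ gram F G = 0 := by
  constructor
  · intro h
    by_contra h0
    exact h (nondegenerate_of_gram_ne_zero h0)
  · intro h
    obtain ⟨T, ⟨r, hr⟩, s, hs⟩ := exists_nullTetrad_of_gram_eq_zero hF h
    exact not_nondegenerate_of_le_borel hF
      (genAlg_le (T.mem_borel_of_mulVec_l hr) (T.mem_borel_of_mulVec_l hs))

theorem isListed_iff (hFG : LinearIndependent ℝ ![F, G]) :
    IsListed (genAlg F G) ↔ gram F G = 0 := by
  have hF : F ≠ 0 := hFG.ne_zero 0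
  constructor
  · intro h
    obtain ⟨T, hT⟩ := h.exists_le_borel
    exact (not_nondegenerate_iff hF).1 (not_nondegenerate_of_le_borel hF hT)
  · intro h
    obtain ⟨T, ⟨r, hr⟩, s, hs⟩ := exists_nullTetrad_of_gram_eq_zero hF h
    exact T.isListed_genAlg (T.mem_borel_of_mulVec_l hr) (T.mem_borel_of_mulVec_l hs) hFG

end Gram

/-! ### Relative positions -/

theorem not_isNullPlane_of_isTimelikePlane {P : Submodule ℝ Vec} (h : IsTimelikePlane P) :
    ¬ IsNullPlane P := by
  rintro ⟨-, x, hxP, hx0, hx⟩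
  obtain ⟨-, u, huP, hu⟩ := h
  have h1 := hx u huP
  have h2 := hx x hxP
  rw [ip_eq] at hu h1 h2
  -- The Cauchy-Schwarz inequality for the spatial parts.
  have hcs : (x 1 * u 1 + x 2 * u 2 + x 3 * u 3) ^ 2 ≤
      (x 1 ^ 2 + x 2 ^ 2 + x 3 ^ 2) * (u 1 ^ 2 + u 2 ^ 2 + u 3 ^ 2) := by
    nlinarith [sq_nonneg (x 1 * u 2 - x 2 * u 1), sq_nonneg (x 1 * u 3 - x 3 * u 1),
      sq_nonneg (x 2 * u 3 - x 3 * u 2)]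
  have e1 : x 1 * u 1 + x 2 * u 2 + x 3 * u 3 = x 0 * u 0 := by linarith
  have e2 : x 1 ^ 2 + x 2 ^ 2 + x 3 ^ 2 = x 0 ^ 2 := by linarith
  rw [e1, e2] at hcs
  have h0 : x 0 = 0 := by
    by_contra hne
    have hpos : 0 < x 0 ^ 2 := by positivity
    have := mul_pos hpos hu
    linarith
  rw [h0] at e2
  have z1 : x 1 = 0 := by nlinarith [sq_nonneg (x 1), sq_nonneg (x 2), sq_nonneg (x 3)]
  have z2 : x 2 = 0 := by nlinarith [sq_nonneg (x 1), sq_nonneg (x 2), sq_nonneg (x 3)]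
  have z3 : x 3 = 0 := by nlinarith [sq_nonneg (x 1), sq_nonneg (x 2), sq_nonneg (x 3)]
  apply hx0
  ext i
  fin_cases i
  exacts [h0, z1, z2, z3]

/-- The plane of a unitary or null two-form is a timelike or null plane, and contains a null
direction. -/
theorem IsUnitaryOrNull.plane_cases {U : TwoForm} (hU : IsUnitaryOrNull U) :
    (IsTimelikePlane (plane U) ∨ IsNullPlane (plane U)) ∧
      ∃ x : Vec, x ≠ 0 ∧ ip x x = 0 ∧ x ∈ plane U := by
  have hspan := hU.plane_eq_span
  have him := hU.im_eq_zero
  have he := hU.electric_pos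
  -- The spanning vectors `x`, `y` are orthogonal, `x` is spacelike, and `y` is timelike or null.
  set x := U.1 *ᵥ ![1, 0, 0, 0] with hx
  set y := U.1 *ᵥ x with hy
  set E := (cvec U 0).re ^ 2 + (cvec U 1).re ^ 2 + (cvec U 2).re ^ 2 with hE
  have hx0 : x = ![0, (cvec U 0).re, (cvec U 1).re, (cvec U 2).re] := by
    rw [hx, val_eq U]
    ext i
    fin_cases i <;> simp [fieldMatrix]
  have hy0 : y 0 = E := by
    rw [hy, hx0, val_eq U]
    simp [fieldMatrix, hE]
    ring
  have hxx : ip x x = -E := by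
    rw [ip_eq, hx0]
    simp [hE]
    ring
  have hxy : ip x y = 0 := by
    have h1 := ip_mulVec_left U x x
    rw [ip_comm (U.1 *ᵥ x)] at h1
    rw [hy]
    linarith
  have hyy : ip y y = E * (cvec U ⬝ᵥ cvec U).re := by
    have hy' : ∀ i, y i = (fieldMatrix (cvec U) *ᵥ ![0, (cvec U 0).re, (cvec U 1).re,
        (cvec U 2).re]) i := fun i => by rw [hy, hx0, val_eq U]
    simp [dotProduct, Fin.sum_univ_three] at him
    rw [ip_eq, hy' 0, hy' 1, hy' 2, hy' 3]
    simp [fieldMatrix, dotProduct, Fin.sum_univ_three, hE]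
    linear_combination (((cvec U 0).re * (cvec U 0).im + (cvec U 1).re * (cvec U 1).im +
      (cvec U 2).re * (cvec U 2).im) / 2) * him
  have mx : x ∈ plane U := by rw [hspan]; exact Submodule.subset_span (by simp)
  have my : y ∈ plane U := by rw [hspan]; exact Submodule.subset_span (by simp)
  have hyne : y ≠ 0 := fun h0 => by rw [h0] at hy0; exact he.ne hy0
  have hli : LinearIndependent ℝ ![x, y] := by
    rw [LinearIndependent.pair_iff]
    intro s t hst
    have ht : t = 0 := by
      have := congrFun hst 0
      rw [Pi.add_apply, Pi.smul_apply, Pi.smul_apply, hy0, hx0] at this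
      simpa [he.ne'] using this
    rw [ht, zero_smul, add_zero] at hst
    refine ⟨(smul_eq_zero.1 hst).resolve_right fun h0 => ?_, ht⟩
    rw [h0] at hxx
    simp [ip] at hxx
    exact he.ne' hxx
  have hrank : Module.finrank ℝ (plane U) = 2 := by
    rw [hspan]
    have := finrank_span_eq_card hli
    rwa [Matrix.range_cons, Matrix.range_cons, Matrix.range_empty, Set.union_empty,
      Set.singleton_union, Fintype.card_fin] at this
  rcases hU.2 with h | h <;> rw [h] at hyy
  · rw [Complex.one_re, mul_one] at hyy
    refine ⟨Or.inl ⟨hrank, y, my, by rw [hyy]; exact he⟩, x + y, ?_, ?_, add_mem mx my⟩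
    · intro h0
      have := congrFun h0 0
      rw [Pi.add_apply, hy0, hx0] at this
      simp at this
      exact he.ne' this
    · rw [ip_add_left, ip_add_right, ip_add_right, ip_comm y x, hxx, hxy, hyy]
      ring
  · rw [Complex.zero_re, mul_zero] at hyy
    refine ⟨Or.inr ⟨hrank, y, my, hyne, ?_⟩, y, hyne, hyy, my⟩
    intro v hv
    rw [hspan, Submodule.mem_span_pair] at hv
    obtain ⟨s, t, rfl⟩ := hv
    rw [ip_add_right, ip_smul_right, ip_smul_right, ip_comm y x, hxy, hyy]
    ring

theorem isNullLine_inf {P Q : Submodule ℝ Vec} (hP : Module.finrank ℝ P = 2)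
    (hQ : Module.finrank ℝ Q = 2) (hne : P ≠ Q) {x : Vec} (hx0 : x ≠ 0) (hx : ip x x = 0)
    (hxP : x ∈ P) (hxQ : x ∈ Q) : IsNullLine (P ⊓ Q) := by
  refine ⟨x, hx0, hx, (Submodule.eq_of_le_of_finrank_le ?_ ?_).symm⟩
  · rw [Submodule.span_singleton_le_iff_mem]
    exact ⟨hxP, hxQ⟩
  · rw [finrank_span_singleton hx0]
    by_contra! hlt
    have h1 : P ⊓ Q = P := Submodule.eq_of_le_of_finrank_le inf_le_left (by omega)
    have h2 : P ⊓ Q = Q := Submodule.eq_of_le_of_finrank_le inf_le_right (by omega)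
    exact hne (h1.symm.trans h2)

theorem ne_of_isNullLine {P Q : Submodule ℝ Vec} (hP : Module.finrank ℝ P = 2)
    (h : IsNullLine (P ⊓ Q)) : P ≠ Q := by
  rintro rfl
  obtain ⟨x, hx0, -, hx⟩ := h
  rw [inf_idem] at hx
  rw [hx, finrank_span_singleton hx0] at hP
  omega

theorem shareNullDirection_iff_existsUnique {U V : TwoForm} (hU : IsUnitaryOrNull U)
    (hV : IsUnitaryOrNull V) : ShareNullDirection (plane U) (plane V) ↔
      ∃! r : RelPos, HasRelPos (plane U) (plane V) r := by
  obtain ⟨hP, x, hx0, hx, hxP⟩ := hU.plane_cases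
  obtain ⟨hQ, -⟩ := hV.plane_cases
  generalize plane U = P at *
  generalize plane V = Q at *
  constructor
  · rintro ⟨y, hy0, hy, hyP, hyQ⟩
    have huniq : ∀ {r s : RelPos}, HasRelPos P Q r → HasRelPos P Q s → s = r := by
      have hP' := @not_isNullPlane_of_isTimelikePlane P
      have hQ' := @not_isNullPlane_of_isTimelikePlane Q
      have hPrank : Module.finrank ℝ P = 2 := hP.elim (·.1) (·.1)
      have hne : IsNullLine (P ⊓ Q) → ¬ P = Q := ne_of_isNullLine hPrank
      intro r s hr hs
      cases r <;> cases s <;> simp only [HasRelPos] at hr hs <;> first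
        | rfl
        | exact absurd hr.1 (hP' hs.1)
        | exact absurd hs.1 (hP' hr.1)
        | exact absurd hr.2 (hne hs.2.2)
        | exact absurd hs.2 (hne hr.2.2)
        | exact absurd hr.2.1 (hQ' hs.2.1)
        | exact absurd hs.2.1 (hQ' hr.2.1)
    have hex : ∃ r : RelPos, HasRelPos P Q r := by
      by_cases hPQ : P = Q
      · rcases hP with hP | hP
        · exact ⟨.p12, hP, hPQ⟩
        · exact ⟨.p11, hP, hPQ⟩
      · have hline := isNullLine_inf (hP.elim (·.1) (·.1)) (hQ.elim (·.1) (·.1)) hPQ hy0 hy hyP hyQ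
        rcases hP with hP | hP <;> rcases hQ with hQ | hQ
        · exact ⟨.p2u3, hP, hQ, hline⟩
        · exact ⟨.p22, hP, hQ, hline⟩
        · exact ⟨.p2u2, hP, hQ, hline⟩
        · exact ⟨.p21, hP, hQ, hline⟩
    obtain ⟨r, hr⟩ := hex
    exact ⟨r, hr, fun s hs => huniq hr hs⟩
  · rintro ⟨r, hr, -⟩
    have hline : IsNullLine (P ⊓ Q) → ShareNullDirection P Q := by
      rintro ⟨y, hy0, hy, hspan⟩
      have hmem : y ∈ P ⊓ Q := by rw [hspan]; exact Submodule.mem_span_singleton_self y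
      exact ⟨y, hy0, hy, hmem.1, hmem.2⟩
    cases r with
    | p11 => exact ⟨x, hx0, hx, hxP, hr.2 ▸ hxP⟩
    | p12 => exact ⟨x, hx0, hx, hxP, hr.2 ▸ hxP⟩
    | p21 => exact hline hr.2.2
    | p22 => exact hline hr.2.2
    | p2u2 => exact hline hr.2.2
    | p2u3 => exact hline hr.2.2

end
end Minkowski

theorem mainTheorem5 (F G U V : Minkowski.TwoForm)
    (hU : Minkowski.HasGeometry F U) (hV : Minkowski.HasGeometry G V) :
    List.TFAE [
      Minkowski.ShareNullDirection (Minkowski.plane U) (Minkowski.plane V),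
      ∃! r : Minkowski.RelPos, Minkowski.HasRelPos (Minkowski.plane U) (Minkowski.plane V) r,
      ¬ (killingForm ℝ (Minkowski.genAlg F G)).Nondegenerate] ∧
    (Minkowski.NonResonant F G →
      (Minkowski.EigenvaluesAdd F G ↔
        Minkowski.ShareNullDirection (Minkowski.plane U) (Minkowski.plane V))) ∧
    (LinearIndependent ℝ ![F, G] →
      (Minkowski.ShareNullDirection (Minkowski.plane U) (Minkowski.plane V) ↔
        (Minkowski.IsR6 (Minkowski.genAlg F G) ∨ Minkowski.IsR7 (Minkowski.genAlg F G) ∨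
          Minkowski.IsR8 (Minkowski.genAlg F G) ∨ Minkowski.IsR11 (Minkowski.genAlg F G) ∨
          Minkowski.IsR12 (Minkowski.genAlg F G) ∨ Minkowski.IsR14 (Minkowski.genAlg F G)))) := by
  have hgram := Minkowski.shareNullDirection_iff hU hV
  refine ⟨?_, fun hN => ?_, fun hFG => ?_⟩
  · tfae_have 1 ↔ 2 := Minkowski.shareNullDirection_iff_existsUnique hU.isUnitaryOrNull
      hV.isUnitaryOrNull
    tfae_have 1 ↔ 3 := by rw [hgram, Minkowski.not_nondegenerate_iff hU.1]
    tfae_finish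
  · rw [hgram]
    exact ⟨Minkowski.gram_eq_zero_of_eigenvaluesAdd hN,
      Minkowski.eigenvaluesAdd_of_gram_eq_zero hN⟩
  · rw [hgram]
    exact (Minkowski.isListed_iff hFG).symm
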